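/- **Setting.** Let $\mathcal H$ be a separable complex Hilbert space, $\mathcal E\subseteq B(\mathcal H)$ a unital $C^*$-algebra, and $(\mathcal E_{[s,t]})_{s\le t}$ unital $*$-subalgebras of $\mathcal E$ with $\mathcal E_{[s',t']}\subseteq\mathcal E_{[s,t]}$ whenever $[s',t']\subseteq[s,t]$. Let $\mathcal E_{\ge t}$ be the norm closure of the algebra generated by $\bigcup_{t'>t}\mathcal E_{[t,t']}$, let $\mathcal E^-$, $\mathcal E_{\ge t}^-$ be closures in the weak operator topology, and $\mathcal E_\infty=\bigcap_{t\in\mathbb R}\mathcal E_{\ge t}^-$. Let $\mathcal X$ be a finite set, and for $t\in\mathbb R$ let $(\Pi_\xi(t))_{\xi\in\mathcal X}$ be commuting orthogonal projections in $\mathcal E_{\ge t}$ with $\sum_{\xi}\Pi_\xi(t)=\mathbf 1$. Let $t_1<t_2<\cdots$ be times, and for a sequence $(\xi_k)$ in $\mathcal X$ put $\Pi_{\underline\xi^{(m,n)}}=\Pi_{\xi_m}(t_m)\cdots\Pi_{\xi_n}(t_n)$ ($=\mathbf 1$ for $m>n$). Assume * (ideal decoherence) $\sum_{\xi_i\in\mathcal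 X}\Pi_{\underline\xi^{(m,n)}}\Pi_{\underline\xi^{(m,n)}}^*=\Pi_{\underline\xi^{(m,i-1)}}\Pi_{\underline\xi^{(i+1,n)}}\big(\Pi_{\underline\xi^{(m,i-1)}}\Pi_{\underline\xi^{(i+1,n)}}\big)^*$ for all $m\le i\le n$; * (asymptotic abelianness) $\mathcal E_\infty$ is contained in the center of $\mathcal E^-$. Let $\Xi=\mathcal X^{\mathbb N}$ with the $\sigma$-algebra $\Sigma$ generated by cylinder sets, let $\Sigma_n$ be the $\sigma$-algebra generated by the sets $\mathcal X^n\times C$ with $C$ a cylinder set, and $\Sigma_\infty=\bigcap_n\Sigma_n$. Let $\omega$ be a normal state on $\mathcal E^-$ (given by a density matrix). There is exactly one probability measure $\mu_\omega$ on $(\Xi,\Sigma)$ that gives the event "the outcomes number $m,\dots,n$ are $\xi_m,\dots,\xi_n$" the probability $\omega\big(\Pi_{\underline\xi^{(m,n)}}\Pi_{\underline\xi^{(m,n)}}^*\big)$, for all $m,n$ and $\underline\xi$. A measure $\rho$ on $\Xi$ is *disintegrated* by a family $(\mu(\cdot|\underline\xi))_{\underline\xi\in\Xi}$ of probability measures if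 $\int_\Lambda\mu(\Delta|\underline\xi)\,d\rho(\underline\xi)=\rho(\Lambda\cap\Delta)$ for all $\Delta\in\Sigma$, $\Lambda\in\Sigma_\infty$. A *$\Sigma_\infty$-ergodic disintegration* of $\mu_\omega$ is such a family that disintegrates $\mu_\omega$, for which $\underline\xi\mapsto\mu(\Delta|\underline\xi)$ is $\Sigma_\infty$-measurable for each $\Delta\in\Sigma$, and such that for $\mu_\omega$-almost every $\underline\xi$ one has $\mu(\Lambda|\underline\xi)\in\{0,1\}$ for all $\Lambda\in\Sigma_\infty$. Given such a family, put $\mathrm{Mol}(\underline\xi)=\{\underline\xi':\mu(\cdot|\underline\xi')=\mu(\cdot|\underline\xi)\}$, let $\widetilde\Xi$ be the set of all $\underline\xi$ such that $\mu(\cdot|\underline\xi)$ is disintegrated by the family and $\mu(\mathrm{Mol}(\underline\xi)|\underline\xi)=1$, let $p:\widetilde\Xi\to\Xi^\infty$ be the quotient map that identifies the points of each molecule, let $\Sigma^\infty$ be the $\sigma$-algebra generated by the sets $E\subseteq\Xi^\infty$ with $p^{-1}(E)\in\Sigma_\infty$, and put $\mu(\cdot|\nu)=\mu(\cdot|\underline\xi)$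 for $\nu=p(\underline\xi)$. **Corollary 1.7.** The measure $\mu_\omega$ has a $\Sigma_\infty$-ergodic disintegration. For every such disintegration, let $\mathcal K$ be the set of all Radon probability measures on $\Xi$ that are disintegrated by $(\mu(\cdot|\underline\xi))_{\underline\xi\in\Xi}$. Then: 1. $\mathcal K$ is convex, and its extreme points are exactly the measures $\mu(\cdot|\nu)$, $\nu\in\Xi^\infty$. 2. $\widetilde\Xi\in\Sigma$, and $\rho(\widetilde\Xi)=1$ for every $\rho\in\mathcal K$. A Radon probability measure $\rho$ belongs to $\mathcal K$ if and only if it is disintegrated by $(\mu(\cdot|\nu))_{\nu\in\Xi^\infty}$, that is, $P(E)=\rho(p^{-1}(E))$ defines a probability measure on $(\Xi^\infty,\Sigma^\infty)$ and $\int_E\mu(\Delta|\nu)\,dP(\nu)=\rho(p^{-1}(E)\cap\Delta)$ for all $\Delta\in\Sigma$, $E\in\Sigma^\infty$. 3. (Choquet-type decomposition) $\mu_\omega\in\mathcal K$; for each $\Delta\in\Sigma$ the function $\nu\mapsto\mu(\Delta|\nu)$ is $\Sigma^\infty$-measurable; and for every $\rho\in\mathcal K$, $P(E)=\rho(p^{-1}(E))$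 defines a probability measure on $(\Xi^\infty,\Sigma^\infty)$ with $\rho=\int_{\Xi^\infty}\mu(\cdot|\nu)\,dP(\nu)$, and $P$ is the only probability measure with this property. In particular this holds for $\rho=\mu_\omega$. -/

import Mathlib

open MeasureTheory
open scoped ENNReal NNReal

noncomputable section

namespace Histories

/-! ### Operator algebras and the quantum-mechanical model -/

section Quantum

variable {H : Type*} [NormedAddCommGroup H] [InnerProductSpace ℂ H] [CompleteSpace H]

/-- The closure of a set of bounded operators in the weak operator topology. -/
def weakClosure (M : Set (H →L[ℂ] H)) : Set (H →L[ℂ] H) :=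
  {A | (ContinuousLinearMapWOT.ofCLM A : H →WOT[ℂ] H) ∈
    closure ((fun B : H →L[ℂ] H => (ContinuousLinearMapWOT.ofCLM B : H →WOT[ℂ] H)) '' M)}

/-- `ω` is a normal state on the set `M` of operators: `ω(A) = tr(P A)` for `A ∈ M`, with the
density matrix `P = ∑ₙ |ψₙ⟩⟨ψₙ|`, `tr P = ∑ₙ ‖ψₙ‖² = 1`. Values of `ω` outside `M` play no role. -/
def IsNormalState (M : Set (H →L[ℂ] H)) (ω : (H →L[ℂ] H) → ℂ) : Prop :=
  ∃ ψ : ℕ → H, HasSum (fun n => ‖ψ n‖ ^ 2) 1 ∧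
    ∀ A ∈ M, HasSum (fun n => inner ℂ (ψ n) (A (ψ n))) (ω A)

variable (H) in
/-- A physical system with a single instrument, with outcomes in the finite set `X`, that is
triggered at times `time 0 < time 1 < ⋯`. -/
structure QuantumSystem (X : Type*) [Fintype X] where
  /-- The C*-algebra `𝓔` generated by all observables. -/
  alg : StarSubalgebra ℂ (H →L[ℂ] H)
  isClosed_alg : IsClosed (alg : Set (H →L[ℂ] H))
  /-- The algebra `𝓔_[s,t]` of the quantities measurable in the time interval `[s,t]`. -/
  loc : ℝ → ℝ → StarSubalgebra ℂ (H →L[ℂ] H)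
  loc_mono : ∀ s s' t' t : ℝ, s ≤ s' → s' ≤ t' → t' ≤ t → loc s' t' ≤ loc s t
  loc_le : ∀ s t : ℝ, s ≤ t → loc s t ≤ alg
  /-- The projections `Π_ξ(t)` representing the instrument at time `t`. -/
  proj : X → ℝ → (H →L[ℂ] H)
  isStarProjection_proj : ∀ x t, IsStarProjection (proj x t)
  proj_mem : ∀ x t, proj x t ∈ (⨆ t' ∈ Set.Ioi t, loc t t').topologicalClosure
  commute_proj : ∀ x y t, Commute (proj x t) (proj y t)
  sum_proj : ∀ t, ∑ x, proj x t = 1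
  /-- The times at which the instrument is triggered. -/
  time : ℕ → ℝ
  strictMono_time : StrictMono time

namespace QuantumSystem

variable {X : Type*} [Fintype X] (S : QuantumSystem H X)

/-- `𝓔_{≥ t}`, a norm closure. -/
def algAfter (t : ℝ) : StarSubalgebra ℂ (H →L[ℂ] H) :=
  (⨆ t' ∈ Set.Ioi t, S.loc t t').topologicalClosure

/-- The von Neumann algebra `𝓔⁻`. -/
def vN : Set (H →L[ℂ] H) := weakClosure (S.alg : Set (H →L[ℂ] H))

/-- The algebra `𝓔_∞ = ⋂ₜ 𝓔_{≥ t}⁻` of asymptotic observables. -/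
def asymptoticAlg : Set (H →L[ℂ] H) :=
  ⋂ t : ℝ, weakClosure (S.algAfter t : Set (H →L[ℂ] H))

/-- The ordered product `Π_{ξ_m}(t_m) ⋯ Π_{ξ_{n-1}}(t_{n-1})`; it is `1` if `n ≤ m`. -/
def historyOp (ξ : ℕ → X) (m n : ℕ) : H →L[ℂ] H :=
  ((List.range' m (n - m)).map fun k => S.proj (ξ k) (S.time k)).prod

/-- Summation over the outcome of the `i`-th measurement removes that measurement. -/
def IdealDecoherence : Prop :=
  ∀ (m i n : ℕ), m ≤ i → i < n → ∀ ξ : ℕ → X,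
    ∑ x : X, S.historyOp (Function.update ξ i x) m n *
        star (S.historyOp (Function.update ξ i x) m n) =
      (S.historyOp ξ m i * S.historyOp ξ (i + 1) n) *
        star (S.historyOp ξ m i * S.historyOp ξ (i + 1) n)

/-- `𝓔_∞` is contained in the center of `𝓔⁻`. -/
def AsymptoticAbelianness : Prop :=
  ∀ A ∈ S.asymptoticAlg, A ∈ S.vN ∧ ∀ B ∈ S.vN, A * B = B * A

/-- `μ` is the law `μ_ω` of histories in the state `ω`: the probability of observing
`ξ_m, …, ξ_{n-1}` in the measurements `m, …, n-1` is `ω(Π Π*)`. -/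
structure IsHistoryMeasure [MeasurableSpace X] (ω : (H →L[ℂ] H) → ℂ)
    (μ : Measure (ℕ → X)) : Prop where
  isProbabilityMeasure : IsProbabilityMeasure μ
  cylinder : ∀ (ξ : ℕ → X) (m n : ℕ),
    ((μ.real {η | ∀ k, m ≤ k → k < n → η k = ξ k} : ℝ) : ℂ) =
      ω (S.historyOp ξ m n * star (S.historyOp ξ m n))

end QuantumSystem

end Quantum

/-! ### Disintegration with respect to the tail σ-algebra -/

section Tail

variable {X : Type*} [MeasurableSpace X]

variable (X) in
/-- The tail σ-algebra `Σ_∞ = ⋂ₙ Σₙ`, where `Σₙ` is generated by the sets `Xⁿ × C`. -/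
@[reducible] def tailAlgebra : MeasurableSpace (ℕ → X) :=
  ⨅ n : ℕ, MeasurableSpace.comap (fun (ξ : ℕ → X) (k : ℕ) => ξ (n + k)) MeasurableSpace.pi

/-- `ρ` is disintegrated with respect to `Σ_∞` by the family `(κ ξ)_ξ`. -/
def IsDisintegratedBy (ρ : Measure (ℕ → X)) (κ : (ℕ → X) → Measure (ℕ → X)) : Prop :=
  ∀ Δ Λ : Set (ℕ → X), MeasurableSet Δ → MeasurableSet[tailAlgebra X] Λ →
    ∫⁻ ξ in Λ, κ ξ Δ ∂ρ = ρ (Λ ∩ Δ)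

/-- `κ` is a `Σ_∞`-ergodic disintegration of `μ`. -/
structure IsErgodicDisintegration (μ : Measure (ℕ → X))
    (κ : (ℕ → X) → Measure (ℕ → X)) : Prop where
  isProbabilityMeasure : ∀ ξ, IsProbabilityMeasure (κ ξ)
  measurable : ∀ Δ : Set (ℕ → X), MeasurableSet Δ →
    Measurable[tailAlgebra X] fun ξ => κ ξ Δ
  isDisintegratedBy : IsDisintegratedBy μ κ
  ergodic : ∀ᵐ ξ ∂μ, ∀ Λ : Set (ℕ → X), MeasurableSet[tailAlgebra X] Λ → κ ξ Λ = 0 ∨ κ ξ Λ = 1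

/-- `Mol(ξ)`. -/
def molecule (κ : (ℕ → X) → Measure (ℕ → X)) (ξ : ℕ → X) : Set (ℕ → X) := {ξ' | κ ξ = κ ξ'}

/-- The set of `ξ` such that `κ ξ` is disintegrated by `κ` and carried by the molecule of `ξ`. -/
def regularSet (κ : (ℕ → X) → Measure (ℕ → X)) : Set (ℕ → X) :=
  {ξ | IsDisintegratedBy (κ ξ) κ ∧ κ ξ (molecule κ ξ) = 1}

/-- Two points are equivalent if they lie in the same molecule. -/
def moleculeSetoid (κ : (ℕ → X) → Measure (ℕ → X)) : Setoid (regularSet κ) :=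
  Setoid.ker fun ξ => κ ξ

/-- The set `Ξ^∞` of molecules. -/
def MoleculeSpace (κ : (ℕ → X) → Measure (ℕ → X)) : Type _ := Quotient (moleculeSetoid κ)

/-- The preimage of a set of molecules, as a set of histories. -/
def preimageMol (κ : (ℕ → X) → Measure (ℕ → X)) (E : Set (MoleculeSpace κ)) : Set (ℕ → X) :=
  Subtype.val '' {ξ : regularSet κ | (Quotient.mk (moleculeSetoid κ) ξ : MoleculeSpace κ) ∈ E}

/-- The σ-algebra `Σ^∞` generated by the sets of molecules with preimage in `Σ_∞`. -/
instance (κ : (ℕ → X) → Measure (ℕ → X)) : MeasurableSpace (MoleculeSpace κ) :=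
  MeasurableSpace.generateFrom {E | MeasurableSet[tailAlgebra X] (preimageMol κ E)}

/-- The measure `μ(· | ν)`, `ν ∈ Ξ^∞`. -/
def molMeasure (κ : (ℕ → X) → Measure (ℕ → X)) (ν : MoleculeSpace κ) : Measure (ℕ → X) :=
  Quotient.lift (s := moleculeSetoid κ) (fun ξ : regularSet κ => κ ξ) (fun _ _ h => h) ν

/-- The set `𝓚` of Radon probability measures on `Ξ` that are disintegrated by `κ`. -/
def disintegratedSet [TopologicalSpace X] (κ : (ℕ → X) → Measure (ℕ → X)) :
    Set (Measure (ℕ → X)) :=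
  {ρ | IsProbabilityMeasure ρ ∧ ρ.Regular ∧ IsDisintegratedBy ρ κ}

/-- `P` is the image on `Ξ^∞` of the measure `ρ`. -/
def IsImage (ρ : Measure (ℕ → X)) (κ : (ℕ → X) → Measure (ℕ → X))
    (P : Measure (MoleculeSpace κ)) : Prop :=
  ∀ E : Set (MoleculeSpace κ), MeasurableSet E → P E = ρ (preimageMol κ E)

/-- `ρ` is disintegrated with respect to `Σ^∞` by `(μ(· | ν))_ν`: its image `P` on `Ξ^∞` is a
probability measure, and `∫_E μ(Δ | ν) dP(ν) = ρ(p⁻¹(E) ∩ Δ)`. -/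
def IsMolDisintegrated (ρ : Measure (ℕ → X)) (κ : (ℕ → X) → Measure (ℕ → X)) : Prop :=
  ∃ P : Measure (MoleculeSpace κ), IsProbabilityMeasure P ∧ IsImage ρ κ P ∧
    ∀ (Δ : Set (ℕ → X)) (E : Set (MoleculeSpace κ)), MeasurableSet Δ → MeasurableSet E →
      ∫⁻ ν in E, molMeasure κ ν Δ ∂P = ρ (preimageMol κ E ∩ Δ)

/-- `ρ = ∫ μ(· | ν) dP(ν)`. -/
def IsMixture (ρ : Measure (ℕ → X)) (κ : (ℕ → X) → Measure (ℕ → X))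
    (P : Measure (MoleculeSpace κ)) : Prop :=
  ∀ Δ : Set (ℕ → X), MeasurableSet Δ → ρ Δ = ∫⁻ ν, molMeasure κ ν Δ ∂P

end Tail

end Histories

end

open Histories

/-! The law of histories exists by Kolmogorov extension. Ideal decoherence for the last outcome says
that the initial cylinder probabilities are consistent; for the first outcome it shows that windows
starting later also get the prescribed probability.

All else is measure theory on the compact metrizable space of histories. The regular conditional
probability given the tail σ-algebra is a disintegration. It is ergodic by Lévy's downward theorem:
`ρ[1_A | Σₙ]` converges in `L¹(ρ)` to `ρ[1_A | Σ_∞]`, hence, by Fatou, arbitrarily well in `L¹(κ ξ)`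
for suitable `n`, for almost every `ξ`. There the limit is constant, because `κ ξ` is carried by the
molecule of `ξ`. So `κ ξ` is mixing (`ae_forall_exists_abs_sub_le`), which is equivalent to tail
triviality (`isTailMixing_iff_isTailTrivial`). As there are only countably many cylinders, mixing is
a countable condition. Therefore `regularSet κ` is a tail event, and every `ρ ∈ 𝓚` gives it full
measure.

An extreme point of `𝓚` is tail trivial, since conditioning on a tail event stays in `𝓚`; it is then
its own conditional law and equals some `κ ξ` by uniqueness of disintegrations. Conversely, an
element of `𝓚` dominated by a regular `κ ξ` lives where `κ` is constantly `κ ξ`, so it is `κ ξ`.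
Finally, `μ(· | ν)` is carried by the molecule `ν`, so a mixing measure can be read off from the
mixture; this gives uniqueness of `P`. -/

namespace Histories

/-! ### Kolmogorov extension for a finite set of outcomes -/

section Kolmogorov

variable {X : Type*}

/-- The histories that agree with `ξ` at the times `m, …, n - 1`. -/
def window (ξ : ℕ → X) (m n : ℕ) : Set (ℕ → X) := {η | ∀ k, m ≤ k → k < n → η k = ξ k}

theorem window_eq_univ (ξ : ℕ → X) {m n : ℕ} (h : n ≤ m) : window ξ m n = Set.univ := by
  ext η
  simp only [window, Set.mem_ofPred_eq, Set.mem_univ, iff_true]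
  intro k h1 h2
  omega

theorem measurableSet_window [MeasurableSpace X] [DiscreteMeasurableSpace X]
    (ξ : ℕ → X) (m n : ℕ) : MeasurableSet (window ξ m n) := by
  have : window ξ m n = ⋂ k, ⋂ (_ : m ≤ k), ⋂ (_ : k < n), (fun η : ℕ → X => η k) ⁻¹' {ξ k} := by
    ext η; simp [window]
  rw [this]
  exact .iInter fun k => .iInter fun _ => .iInter fun _ => measurable_pi_apply k (.of_discrete)

theorem isClopen_window [TopologicalSpace X] [DiscreteTopology X] (ξ : ℕ → X) (m n : ℕ) :
    IsClopen (window ξ m n) := by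
  have : window ξ m n = ⋂ k ∈ Finset.Ico m n, (fun η : ℕ → X => η k) ⁻¹' {ξ k} := by
    ext η; simp [window]
  rw [this]
  exact isClopen_biInter_finset fun k _ => (isClopen_discrete _).preimage (continuous_apply k)

theorem window_update (ξ : ℕ → X) (m i n : ℕ) (x : X) (hm : m ≤ i) (hn : i < n) :
    window (Function.update ξ i x) m n =
      {η | (∀ k, m ≤ k → k < n → k ≠ i → η k = ξ k) ∧ η i = x} := by
  ext η
  simp only [window, Set.mem_ofPred_eq]
  refine ⟨fun h => ⟨fun k h1 h2 h3 => ?_, ?_⟩, fun h k h1 h2 => ?_⟩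
  · simpa [h3] using h k h1 h2
  · simpa using h i hm hn
  · rcases eq_or_ne k i with rfl | h3
    · simpa using h.2
    · simpa [h3] using h.1 k h1 h2 h3

/-- The measure-theoretic counterpart of `IdealDecoherence`, needed for the last and the first
outcome. -/
theorem measure_agree_eq_sum_window [Fintype X] [MeasurableSpace X] [DiscreteMeasurableSpace X]
    (μ : Measure (ℕ → X)) (ξ : ℕ → X) (m i n : ℕ) (hm : m ≤ i) (hn : i < n) :
    μ {η | ∀ k, m ≤ k → k < n → k ≠ i → η k = ξ k} =
      ∑ x, μ (window (Function.update ξ i x) m n) := by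
  rw [← measure_biUnion_finset]
  · congr 1
    ext η
    simp [window_update _ _ _ _ _ hm hn]
  · intro x _ y _ hxy
    rw [Function.onFun, window_update _ _ _ _ _ hm hn, window_update _ _ _ _ _ hm hn,
      Set.disjoint_left]
    rintro η ⟨-, h1⟩ ⟨-, h2⟩
    exact hxy (h1.symm.trans h2)
  · exact fun x _ => measurableSet_window _ _ _

theorem measure_window_eq_sum_last [Fintype X] [MeasurableSpace X] [DiscreteMeasurableSpace X]
    (μ : Measure (ℕ → X)) (ξ : ℕ → X) (n : ℕ) :
    μ (window ξ 0 n) = ∑ x, μ (window (Function.update ξ n x) 0 (n + 1)) := by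
  rw [← measure_agree_eq_sum_window μ ξ 0 n (n + 1) (Nat.zero_le _) (Nat.lt_succ_self _)]
  congr 1
  ext η
  exact ⟨fun h k h1 h2 h3 => h k h1 (by omega), fun h k h1 h2 => h k h1 (by omega) (by omega)⟩

theorem measure_window_eq_sum_first [Fintype X] [MeasurableSpace X] [DiscreteMeasurableSpace X]
    (μ : Measure (ℕ → X)) (ξ : ℕ → X) (m n : ℕ) (h : m < n) :
    μ (window ξ (m + 1) n) = ∑ x, μ (window (Function.update ξ m x) m n) := by
  rw [← measure_agree_eq_sum_window μ ξ m m n le_rfl h]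
  congr 1
  ext η
  exact ⟨fun h k h1 h2 h3 => h k (by omega) h2, fun h k h1 h2 => h k (by omega) h2 (by omega)⟩

/-- A probability measure on histories is determined by the law of the initial segments. -/
theorem ext_of_window [Finite X] [Nonempty X] [MeasurableSpace X] [DiscreteMeasurableSpace X]
    (μ ν : Measure (ℕ → X)) [IsFiniteMeasure μ]
    (h : ∀ ξ n, μ (window ξ 0 n) = ν (window ξ 0 n)) : μ = ν := by
  inhabit X
  have hgen : (MeasurableSpace.pi : MeasurableSpace (ℕ → X)) =
      MeasurableSpace.generateFrom ({∅} ∪ {s | ∃ ξ n, s = window ξ 0 n}) := by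
    refine le_antisymm (iSup_le fun i => ?_) (MeasurableSpace.generateFrom_le ?_)
    · rintro _ ⟨T, -, rfl⟩
      have : (fun η : ℕ → X => η i) ⁻¹' T = ⋃ a : {a : Fin (i + 1) → X // a (Fin.last i) ∈ T},
          window (fun k => if h : k < i + 1 then a.1 ⟨k, h⟩ else default) 0 (i + 1) := by
        ext η
        simp only [Set.mem_preimage, Set.mem_iUnion, Subtype.exists, window, Set.mem_ofPred_eq]
        constructor
        · intro hη
          refine ⟨fun k => η k, by simpa using hη, fun k _ hk => by simp [hk]⟩
        · rintro ⟨a, ha, hη⟩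
          have := hη i (Nat.zero_le _) (Nat.lt_succ_self _)
          simp only [Nat.lt_succ_self, dite_true] at this
          rw [this]
          exact ha
      rw [this]
      exact MeasurableSet.iUnion fun a =>
        MeasurableSpace.measurableSet_generateFrom (Or.inr ⟨_, _, rfl⟩)
    · rintro _ (rfl | ⟨ξ, n, rfl⟩)
      · exact MeasurableSet.empty
      · exact measurableSet_window _ _ _
  have hpi : IsPiSystem ({∅} ∪ {s : Set (ℕ → X) | ∃ ξ n, s = window ξ 0 n}) := by
    rintro _ (rfl | ⟨ξ, n, rfl⟩) _ (rfl | ⟨ξ', n', rfl⟩) hne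
    · simp
    · simp
    · simp
    · obtain ⟨η, h1, h2⟩ := hne
      -- Both windows are windows of any common point `η`, so their intersection is the longer one.
      refine Or.inr ⟨η, max n n', ?_⟩
      ext ζ
      simp only [window, Set.mem_inter_iff, Set.mem_ofPred_eq, zero_le, true_implies] at h1 h2 ⊢
      constructor
      · rintro ⟨h3, h4⟩ k hk
        rcases lt_max_iff.1 hk with hk | hk
        · rw [h3 k hk, h1 k hk]
        · rw [h4 k hk, h2 k hk]
      · intro h3
        exact ⟨fun k hk => by rw [h3 k (lt_max_of_lt_left hk), h1 k hk],
          fun k hk => by rw [h3 k (lt_max_of_lt_right hk), h2 k hk]⟩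
  refine ext_of_generate_finite _ hgen hpi ?_ ?_
  · rintro _ (rfl | ⟨ξ, n, rfl⟩)
    · simp
    · exact h ξ n
  · rw [← window_eq_univ (fun _ => default) (le_refl 0)]
    exact h _ _

/-- Kolmogorov's extension theorem for sequences with values in a finite set. -/
theorem exists_measure_window [Fintype X] [Nonempty X] [MeasurableSpace X]
    [DiscreteMeasurableSpace X]
    (p : (ℕ → X) → ℕ → ℝ≥0) (hdep : ∀ ξ η n, (∀ k < n, ξ k = η k) → p ξ n = p η n)
    (h0 : ∀ ξ, p ξ 0 = 1) (hsum : ∀ ξ n, ∑ x, p (Function.update ξ n x) (n + 1) = p ξ n) :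
    ∃ μ : Measure (ℕ → X), IsProbabilityMeasure μ ∧ ∀ ξ n, μ (window ξ 0 n) = p ξ n := by
  classical
  let _ : TopologicalSpace X := ⊥
  have : DiscreteTopology X := ⟨rfl⟩
  inhabit X
  -- A sum of point masses at sequences continued by `default` has the right law up to time `n`;
  -- consistency carries this down to every `k ≤ n`.
  have hfin : ∀ n, ∃ μ : Measure (ℕ → X), ∀ k ≤ n, ∀ ξ, μ (window ξ 0 k) = p ξ k := by
    intro n
    let e : (Fin n → X) → ℕ → X := fun a k => if h : k < n then a ⟨k, h⟩ else default
    refine ⟨∑ a, (p (e a) n : ℝ≥0∞) • Measure.dirac (e a), fun k hk => ?_⟩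
    induction hk using Nat.decreasingInduction with
    | self =>
      intro ξ
      rw [Measure.finsetSum_apply, Finset.sum_eq_single (fun k : Fin n => ξ k)]
      · have hmem : e (fun k : Fin n => ξ k) ∈ window ξ 0 n := fun k _ hk => by simp [e, hk]
        simp only [Measure.smul_apply, smul_eq_mul,
          Measure.dirac_apply' _ (measurableSet_window ξ 0 n), Set.indicator_of_mem hmem,
          Pi.one_apply, mul_one]
        rw [hdep _ ξ n fun k hk => hmem k (Nat.zero_le _) hk]
      · intro a _ ha
        have hmem : e a ∉ window ξ 0 n := by
          intro h
          refine ha (funext fun k => ?_)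
          have := h k (Nat.zero_le _) k.2
          simpa [e] using this
        simp [Measure.dirac_apply' _ (measurableSet_window ξ 0 n), hmem]
      · simp
    | of_succ k hk ih =>
      intro ξ
      rw [measure_window_eq_sum_last, ← hsum ξ k]
      push_cast
      exact Finset.sum_congr rfl fun x _ => ih _
  choose ν hν using hfin
  have hprob : ∀ n, IsProbabilityMeasure (ν n) := fun n =>
    ⟨by rw [← window_eq_univ (fun _ => default) (le_refl 0), hν n 0 (Nat.zero_le _), h0]; rfl⟩
  let N : ℕ → ProbabilityMeasure (ℕ → X) := fun n => ⟨ν n, hprob n⟩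
  -- Probability measures on a compact space form a compact set. Windows are clopen, so their
  -- probabilities pass to the limit, and each is eventually constant.
  obtain ⟨μ, -, hμ⟩ := isCompact_univ.ultrafilter_le_nhds
    ((Filter.hyperfilter ℕ).map N) (by simp)
  refine ⟨μ, inferInstance, fun ξ n => ?_⟩
  have hlim := ProbabilityMeasure.tendsto_measure_of_null_frontier_of_tendsto'
    (L := (Filter.hyperfilter ℕ : Filter ℕ)) (μs := N) (μ := μ) hμ
    (E := window ξ 0 n) (by rw [(isClopen_window ξ 0 n).frontier_eq, measure_empty])
  refine tendsto_nhds_unique hlim (tendsto_const_nhds.congr' ?_)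
  have : ∀ᶠ k in (Filter.hyperfilter ℕ : Filter ℕ), n ≤ k :=
    Nat.hyperfilter_le_atTop (Filter.eventually_ge_atTop n)
  filter_upwards [this] with k hk
  exact (hν k n hk ξ).symm

end Kolmogorov

/-! ### The law of histories of a quantum system -/

section Quantum

variable {H : Type*} [NormedAddCommGroup H] [InnerProductSpace ℂ H]

theorem subset_weakClosure (M : Set (H →L[ℂ] H)) : M ⊆ weakClosure M :=
  fun A hA => subset_closure ⟨A, hA, rfl⟩

namespace QuantumSystem

variable [CompleteSpace H] {X : Type*} [Fintype X] (S : QuantumSystem H X)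

theorem proj_mem_alg (x : X) (t : ℝ) : S.proj x t ∈ S.alg :=
  StarSubalgebra.topologicalClosure_minimal
    (iSup₂_le fun t' ht => S.loc_le t t' (le_of_lt ht)) S.isClosed_alg (S.proj_mem x t)

theorem historyOp_mem_alg (ξ : ℕ → X) (m n : ℕ) : S.historyOp ξ m n ∈ S.alg := by
  refine list_prod_mem fun A hA => ?_
  obtain ⟨k, -, rfl⟩ := List.mem_map.1 hA
  exact S.proj_mem_alg _ _

theorem historyOp_mul_star_mem_alg (ξ : ℕ → X) (m n : ℕ) :
    S.historyOp ξ m n * star (S.historyOp ξ m n) ∈ S.alg :=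
  mul_mem (S.historyOp_mem_alg _ _ _) (star_mem (S.historyOp_mem_alg _ _ _))

theorem historyOp_of_le (ξ : ℕ → X) {m n : ℕ} (h : n ≤ m) : S.historyOp ξ m n = 1 := by
  simp [historyOp, Nat.sub_eq_zero_of_le h]

theorem historyOp_congr {ξ η : ℕ → X} {m n : ℕ} (h : ∀ k, m ≤ k → k < n → ξ k = η k) :
    S.historyOp ξ m n = S.historyOp η m n := by
  rw [historyOp, historyOp]
  congr 1
  refine List.map_congr_left fun k hk => ?_
  rw [List.mem_range'_1] at hk
  rw [h k hk.1 (by omega)]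

end QuantumSystem

theorem IsNormalState.map_sum {M : Set (H →L[ℂ] H)} {ω : (H →L[ℂ] H) → ℂ}
    (hω : IsNormalState M ω) {ι : Type*} (s : Finset ι) (A : ι → H →L[ℂ] H)
    (hA : ∀ i ∈ s, A i ∈ M) (hs : ∑ i ∈ s, A i ∈ M) : ω (∑ i ∈ s, A i) = ∑ i ∈ s, ω (A i) := by
  obtain ⟨ψ, -, h⟩ := hω
  refine (h _ hs).unique ?_
  have := hasSum_sum fun i hi => h (A i) (hA i hi)
  convert this using 2 with n
  rw [_root_.sum_apply, inner_sum]

theorem IsNormalState.map_one {M : Set (H →L[ℂ] H)} {ω : (H →L[ℂ] H) → ℂ}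
    (hω : IsNormalState M ω) (h1 : (1 : H →L[ℂ] H) ∈ M) : ω 1 = 1 := by
  obtain ⟨ψ, hψ, h⟩ := hω
  refine (h 1 h1).unique ?_
  have := (Complex.hasSum_ofReal).2 hψ
  convert this using 2 with n
  · simp [inner_self_eq_norm_sq_to_K]
  · simp

theorem IsNormalState.map_mul_star_nonneg [CompleteSpace H] {M : Set (H →L[ℂ] H)} {ω : (H →L[ℂ] H) → ℂ}
    (hω : IsNormalState M ω) (A : H →L[ℂ] H) (hA : A * star A ∈ M) :
    ∃ r : ℝ≥0, ω (A * star A) = (r : ℝ) := by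
  obtain ⟨ψ, hψ, h⟩ := hω
  have h1 : ∀ n, inner ℂ (ψ n) ((A * star A) (ψ n)) = ((‖star A (ψ n)‖ ^ 2 : ℝ) : ℂ) := by
    intro n
    rw [mul_apply_eq_comp, ContinuousLinearMap.star_eq_adjoint,
      ← ContinuousLinearMap.adjoint_inner_left, inner_self_eq_norm_sq_to_K]
    simp
  have h2 := h _ hA
  simp_rw [h1] at h2
  have h3 : Summable fun n => ‖star A (ψ n)‖ ^ 2 := by
    have := h2.summable
    exact_mod_cast this
  have h4 := h2.unique ((Complex.hasSum_ofReal).2 h3.hasSum)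
  exact ⟨⟨_, tsum_nonneg fun n => sq_nonneg _⟩, h4⟩

theorem IsNormalState.nontrivial {M : Set (H →L[ℂ] H)} {ω : (H →L[ℂ] H) → ℂ}
    (hω : IsNormalState M ω) : Nontrivial H := by
  by_contra hH
  rw [not_nontrivial_iff_subsingleton] at hH
  obtain ⟨ψ, hψ, -⟩ := hω
  have : (fun n => ‖ψ n‖ ^ 2) = fun _ => (0 : ℝ) := by
    ext n
    rw [Subsingleton.elim (ψ n) 0]
    simp
  rw [this] at hψ
  exact zero_ne_one (hasSum_zero.unique hψ)

namespace QuantumSystem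

variable [CompleteSpace H] {X : Type*} [Fintype X] (S : QuantumSystem H X)

theorem nonempty_of_isNormalState (S : QuantumSystem H X) {M : Set (H →L[ℂ] H)} {ω : (H →L[ℂ] H) → ℂ}
    (hω : IsNormalState M ω) : Nonempty X := by
  by_contra hX
  rw [not_nonempty_iff] at hX
  have := hω.nontrivial
  have h := S.sum_proj 0
  rw [Finset.univ_eq_empty, Finset.sum_empty] at h
  exact zero_ne_one h

/-- The prescribed probabilities have the form `ω(AA*)`, hence are nonnegative; ideal decoherence
makes them consistent. Windows starting at time `0` already determine the measure. -/
theorem existsUnique_isHistoryMeasure [MeasurableSpace X] [DiscreteMeasurableSpace X]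
    (hdec : S.IdealDecoherence) {ω : (H →L[ℂ] H) → ℂ} (hω : IsNormalState S.vN ω) :
    ∃! μ : Measure (ℕ → X), S.IsHistoryMeasure ω μ := by
  have hne : Nonempty X := S.nonempty_of_isNormalState hω
  have hvN : ∀ ξ m n, S.historyOp ξ m n * star (S.historyOp ξ m n) ∈ S.vN := fun ξ m n =>
    subset_weakClosure _ (S.historyOp_mul_star_mem_alg ξ m n)
  choose q hq using fun (ξ : ℕ → X) m n => hω.map_mul_star_nonneg (S.historyOp ξ m n) (hvN ξ m n)
  have hq_inj : ∀ {a b : ℝ≥0}, (((a : ℝ) : ℂ) = ((b : ℝ) : ℂ)) → a = b := fun h => by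
    exact_mod_cast h
  have hq_one : ∀ ξ m n, n ≤ m → q ξ m n = 1 := fun ξ m n h => hq_inj <| by
    rw [← hq, S.historyOp_of_le ξ h, star_one, mul_one, hω.map_one]
    · simp
    · exact subset_weakClosure _ (one_mem S.alg)
  have hq_congr : ∀ ξ η m n, (∀ k, m ≤ k → k < n → ξ k = η k) → q ξ m n = q η m n :=
    fun ξ η m n h => hq_inj <| by rw [← hq, ← hq, S.historyOp_congr h]
  have hsum : ∀ ξ m i n, m ≤ i → i < n →
      ω ((S.historyOp ξ m i * S.historyOp ξ (i + 1) n) *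
        star (S.historyOp ξ m i * S.historyOp ξ (i + 1) n)) =
      ((∑ x, q (Function.update ξ i x) m n : ℝ≥0) : ℝ) := by
    intro ξ m i n hm hn
    have hd := hdec m i n hm hn ξ
    rw [← hd, hω.map_sum]
    · simp_rw [hq]
      push_cast
      rfl
    · exact fun x _ => hvN _ _ _
    · exact subset_weakClosure _ (sum_mem fun x _ => S.historyOp_mul_star_mem_alg _ _ _)
  have hq_last : ∀ ξ n, ∑ x, q (Function.update ξ n x) 0 (n + 1) = q ξ 0 n := fun ξ n =>
    hq_inj <| by
      rw [← hsum ξ 0 n (n + 1) (Nat.zero_le _) (Nat.lt_succ_self _), ← hq,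
        S.historyOp_of_le ξ (le_refl (n + 1)), mul_one]
  have hq_first : ∀ ξ m n, m < n → ∑ x, q (Function.update ξ m x) m n = q ξ (m + 1) n :=
    fun ξ m n h => hq_inj <| by
      rw [← hsum ξ m m n le_rfl h, ← hq, S.historyOp_of_le ξ (le_refl m), one_mul]
  obtain ⟨μ, hμ, hμq⟩ := exists_measure_window (fun ξ n => q ξ 0 n)
    (fun ξ η n h => hq_congr ξ η 0 n fun k _ hk => h k hk) (fun ξ => hq_one ξ 0 0 le_rfl) hq_last
  -- Both sides satisfy the same recursion in `m`: summation over the first outcome.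
  have hμw : ∀ m ξ n, μ (window ξ m n) = q ξ m n := by
    intro m
    induction m with
    | zero => exact hμq
    | succ m ih =>
      intro ξ n
      rcases lt_or_ge m n with h | h
      · rw [measure_window_eq_sum_first _ _ _ _ h, ← hq_first ξ m n h]
        push_cast
        exact Finset.sum_congr rfl fun x _ => ih _ _
      · rw [window_eq_univ ξ (h.trans (Nat.le_succ m)), hq_one ξ _ _ (h.trans (Nat.le_succ m)),
          measure_univ]
        rfl
  refine ⟨μ, ⟨hμ, fun ξ m n => ?_⟩, fun ν hν => ?_⟩
  · rw [hq ξ m n]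
    congr 1
    change (μ (window ξ m n)).toReal = _
    rw [hμw]
    rfl
  · have := hν.isProbabilityMeasure
    refine ext_of_window ν μ fun ξ n => ?_
    have h := hν.cylinder ξ 0 n
    rw [hq ξ 0 n, Complex.ofReal_inj] at h
    rw [hμw, ← ENNReal.ofReal_coe_nnreal, ← h]
    exact (ofReal_measureReal).symm

end QuantumSystem

end Quantum

/-! ### Lévy's downward theorem -/

section DownwardMartingale

open Filter Topology

/-- Orthogonal projections onto a decreasing sequence of closed subspaces converge strongly to the
projection onto the intersection. -/
theorem starProjection_tendsto_iInf {E : Type*} [NormedAddCommGroup E] [InnerProductSpace ℝ E]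
    [CompleteSpace E] (U : ℕ → Submodule ℝ E) [∀ i, (U i).HasOrthogonalProjection]
    [(⨅ i, U i).HasOrthogonalProjection] (hU : Antitone U) (x : E) :
    Tendsto (fun i => (U i).starProjection x) atTop (𝓝 ((⨅ i, U i).starProjection x)) := by
  -- The orthogonal complements increase, and the projection onto `U i` is the identity minus that
  -- onto its complement.
  have hmono : Monotone fun i => (U i)ᗮ := fun i j h => Submodule.orthogonal_le (hU h)
  have hcl : (⨆ i, (U i)ᗮ).topologicalClosure = (⨅ i, U i)ᗮ := by
    rw [← Submodule.orthogonal_orthogonal_eq_closure, ← Submodule.iInf_orthogonal]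
    simp
  have h := Submodule.starProjection_tendsto_closure_iSup (fun i => (U i)ᗮ) hmono x
  have h2 := (tendsto_const_nhds (x := x)).sub h
  convert h2 using 2
  · rename_i i
    simp
  · simp [hcl]

variable {Ω : Type*} {m0 : MeasurableSpace Ω}

/-- The representatives `g n` may differ on null sets, but their `limsup` ignores the first `N` of
them, so it is `m N`-measurable for every `N`. -/
theorem aestronglyMeasurable_iInf {μ : Measure Ω} {m : ℕ → MeasurableSpace Ω} (hm : Antitone m)
    {f : Ω → ℝ} (hf : ∀ n, AEStronglyMeasurable[m n] f μ) :
    AEStronglyMeasurable[⨅ n, m n] f μ := by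
  choose g hg hfg using hf
  let G : Ω → ℝ := fun ω => limsup (fun n => g n ω) atTop
  have hG : Measurable[⨅ n, m n] G := by
    refine fun s hs => ?_
    rw [MeasurableSpace.measurableSet_iInf]
    intro N
    have hGN : G = fun ω => limsup (fun n => g (n + N) ω) atTop := by
      ext ω
      exact (limsup_nat_add (fun n => g n ω) N).symm
    have : Measurable[m N] G := by
      rw [hGN]
      let _ := m N
      exact Measurable.limsup fun n =>
        ((hg (n + N)).mono (hm (Nat.le_add_left N n))).measurable
    exact this hs
  refine ⟨G, hG.stronglyMeasurable, ?_⟩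
  filter_upwards [ae_all_iff.2 hfg] with ω hω
  simp only [G, ← hω, limsup_const]

theorem lpMeas_iInf {μ : Measure Ω} {m : ℕ → MeasurableSpace Ω} (hm : Antitone m) :
    lpMeas ℝ ℝ (⨅ n, m n) 2 μ = ⨅ n, lpMeas ℝ ℝ (m n) 2 μ := by
  ext f
  simp only [Submodule.mem_iInf, mem_lpMeas_iff_aestronglyMeasurable]
  exact ⟨fun h n => h.mono (iInf_le m n), aestronglyMeasurable_iInf hm⟩

/-- **Lévy's downward theorem** in mean. -/
theorem tendsto_eLpNorm_condExp_iInf (μ : Measure Ω) [IsProbabilityMeasure μ]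
    {m : ℕ → MeasurableSpace Ω} (hm : Antitone m) (hle : ∀ n, m n ≤ m0) {f : Ω → ℝ}
    (hf : MemLp f 2 μ) :
    Tendsto (fun n => eLpNorm (μ[f | m n] - μ[f | ⨅ n, m n]) 1 μ) atTop (𝓝 0) := by
  have hle' : ⨅ n, m n ≤ m0 := (iInf_le m 0).trans (hle 0)
  have hF : ∀ n, Fact (m n ≤ m0) := fun n => ⟨hle n⟩
  have hF' : Fact (⨅ n, m n ≤ m0) := ⟨hle'⟩
  have hanti : Antitone fun n => lpMeas ℝ ℝ (m n) 2 μ := fun i j h g hg => by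
    rw [mem_lpMeas_iff_aestronglyMeasurable] at hg ⊢
    exact hg.mono (hm h)
  have hproj : (⨅ n, lpMeas ℝ ℝ (m n) 2 μ).HasOrthogonalProjection := by
    rw [← lpMeas_iInf hm]; infer_instance
  -- On `L²`, conditional expectation is the orthogonal projection onto `lpMeas`; on a probability
  -- space the `L¹` norm is at most the `L²` norm.
  have h := starProjection_tendsto_iInf (fun n => lpMeas ℝ ℝ (m n) 2 μ) hanti hf.toLp
  have heq : (⨅ n, lpMeas ℝ ℝ (m n) 2 μ).starProjection hf.toLp =
      ((condExpL2 ℝ ℝ hle' hf.toLp : lpMeas ℝ ℝ (⨅ n, m n) 2 μ) : Lp ℝ 2 μ) := by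
    rw [condExpL2]
    simp only [← lpMeas_iInf hm]
    rfl
  rw [heq, Lp.tendsto_Lp_iff_tendsto_eLpNorm'] at h
  refine tendsto_of_tendsto_of_tendsto_of_le_of_le tendsto_const_nhds h
    (fun _ => zero_le) fun n => ?_
  have hae : μ[f | m n] - μ[f | ⨅ n, m n] =ᵐ[μ]
      (((lpMeas ℝ ℝ (m n) 2 μ).starProjection hf.toLp : Lp ℝ 2 μ) : Ω → ℝ) -
        ((condExpL2 ℝ ℝ hle' hf.toLp : Lp ℝ 2 μ) : Ω → ℝ) :=
    (hf.condExpL2_ae_eq_condExp (𝕜 := ℝ) (hle n)).symm.sub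
      (hf.condExpL2_ae_eq_condExp (𝕜 := ℝ) hle').symm
  simp only [eLpNorm_congr_ae hae]
  exact eLpNorm_le_eLpNorm_of_exponent_le one_le_two
    ((Lp.aestronglyMeasurable _).sub (Lp.aestronglyMeasurable _))

end DownwardMartingale

open Filter Topology ProbabilityTheory

section Tail

variable {X : Type*} [MeasurableSpace X]

/-! ### Cylinders and the tail σ-algebra -/

variable (X) in
/-- The σ-algebra `Σₙ` of events that depend only on the outcomes number `n, n + 1, …`. -/
@[reducible] def shiftAlgebra (n : ℕ) : MeasurableSpace (ℕ → X) :=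
  MeasurableSpace.comap (fun (ξ : ℕ → X) (k : ℕ) => ξ (n + k)) MeasurableSpace.pi

variable (X) in
/-- The algebra of the sets `Xⁿ × C`, where `C` is a cylinder. -/
def shiftCylinders (n : ℕ) : Set (Set (ℕ → X)) :=
  Set.preimage (fun (ξ : ℕ → X) (k : ℕ) => ξ (n + k)) '' measurableCylinders fun _ : ℕ => X

theorem generateFrom_shiftCylinders (n : ℕ) :
    shiftAlgebra X n = MeasurableSpace.generateFrom (shiftCylinders X n) := by
  rw [shiftCylinders, ← MeasurableSpace.comap_generateFrom, generateFrom_measurableCylinders]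

theorem isSetAlgebra_shiftCylinders (n : ℕ) : IsSetAlgebra (shiftCylinders X n) where
  empty_mem := ⟨∅, empty_mem_measurableCylinders _, rfl⟩
  compl_mem := by
    rintro _ ⟨C, hC, rfl⟩
    exact ⟨Cᶜ, compl_mem_measurableCylinders hC, rfl⟩
  union_mem := by
    rintro _ _ ⟨C, hC, rfl⟩ ⟨D, hD, rfl⟩
    exact ⟨C ∪ D, union_mem_measurableCylinders hC hD, rfl⟩

/-- There are countably many finite sets of coordinates and, `X` being finite, finitely many
cylinders over each. This lets almost sure statements hold for all cylinders at once. -/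
theorem countable_shiftCylinders [Finite X] (n : ℕ) : (shiftCylinders X n).Countable := by
  refine Set.Countable.image ?_ _
  have : measurableCylinders (fun _ : ℕ => X) ⊆
      ⋃ s : Finset ℕ, Set.range fun S : Set (s → X) => cylinder s S := by
    intro C hC
    obtain ⟨s, S, -, rfl⟩ := (mem_measurableCylinders _).1 hC
    exact Set.mem_iUnion.2 ⟨s, S, rfl⟩
  exact (Set.countable_iUnion fun s => Set.countable_range _).mono this

theorem shiftAlgebra_zero : shiftAlgebra X 0 = MeasurableSpace.pi := by
  have : (fun (ξ : ℕ → X) (k : ℕ) => ξ (0 + k)) = id := by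
    ext ξ k; simp
  rw [shiftAlgebra, this, MeasurableSpace.comap_id]

theorem antitone_shiftAlgebra : Antitone (shiftAlgebra X) := by
  refine antitone_nat_of_succ_le fun n => ?_
  have : (fun (ξ : ℕ → X) (k : ℕ) => ξ (n + 1 + k)) =
      (fun (ξ : ℕ → X) (k : ℕ) => ξ (1 + k)) ∘ fun (ξ : ℕ → X) (k : ℕ) => ξ (n + k) := by
    ext ξ k; simp [add_assoc]
  rw [shiftAlgebra, this, ← MeasurableSpace.comap_comp]
  refine MeasurableSpace.comap_mono ?_
  rw [← measurable_iff_comap_le]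
  exact measurable_pi_lambda _ fun k => measurable_pi_apply _

theorem shiftAlgebra_le (n : ℕ) : shiftAlgebra X n ≤ MeasurableSpace.pi :=
  (antitone_shiftAlgebra (Nat.zero_le n)).trans_eq shiftAlgebra_zero

theorem tailAlgebra_le_shiftAlgebra (n : ℕ) : tailAlgebra X ≤ shiftAlgebra X n := iInf_le _ n

theorem tailAlgebra_le : tailAlgebra X ≤ MeasurableSpace.pi :=
  (tailAlgebra_le_shiftAlgebra 0).trans (shiftAlgebra_le 0)

theorem measurableSet_of_mem_shiftCylinders {n : ℕ} {B : Set (ℕ → X)}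
    (hB : B ∈ shiftCylinders X n) : MeasurableSet[shiftAlgebra X n] B := by
  rw [generateFrom_shiftCylinders]
  exact MeasurableSpace.measurableSet_generateFrom hB

theorem measurableSet_of_mem_shiftCylinders' {n : ℕ} {B : Set (ℕ → X)}
    (hB : B ∈ shiftCylinders X n) : MeasurableSet B :=
  shiftAlgebra_le n _ (measurableSet_of_mem_shiftCylinders hB)

theorem ext_of_shiftCylinders {μ ν : Measure (ℕ → X)} [IsProbabilityMeasure μ]
    [IsProbabilityMeasure ν] (h : ∀ A ∈ shiftCylinders X 0, μ A = ν A) : μ = ν :=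
  ext_of_generate_finite _ (shiftAlgebra_zero.symm.trans (generateFrom_shiftCylinders 0))
    (isSetAlgebra_shiftCylinders 0).isSetRing.isSetSemiring.isPiSystem h (by simp)

theorem ext_of_shiftCylinders_real {μ ν : Measure (ℕ → X)} [IsProbabilityMeasure μ]
    [IsProbabilityMeasure ν] (h : ∀ A ∈ shiftCylinders X 0, μ.real A = ν.real A) : μ = ν :=
  ext_of_shiftCylinders fun A hA => (measureReal_eq_measureReal_iff).1 (h A hA)

theorem exists_mem_measure_symmDiff_lt {Ω : Type*} {m : MeasurableSpace Ω} (ν : Measure Ω)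
    [IsFiniteMeasure ν] {𝒜 : Set (Set Ω)} (h𝒜 : IsSetAlgebra 𝒜)
    (hgen : m = MeasurableSpace.generateFrom 𝒜) {Λ : Set Ω} (hΛ : MeasurableSet Λ) {ε : ℝ}
    (hε : 0 < ε) : ∃ B ∈ 𝒜, ν (symmDiff Λ B) < ENNReal.ofReal ε :=
  (Measure.MeasureDense.of_generateFrom_isSetAlgebra_finite ν h𝒜 hgen).approx Λ hΛ
    (measure_ne_top _ _) ε hε

/-- Trimming `ν` to `Σₙ` forces the approximating set to come from the algebra generating `Σₙ`. -/
theorem exists_shiftCylinders_measureReal_symmDiff_lt (ν : Measure (ℕ → X))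
    [IsProbabilityMeasure ν] {n : ℕ} {Λ : Set (ℕ → X)} (hΛ : MeasurableSet[shiftAlgebra X n] Λ)
    {ε : ℝ} (hε : 0 < ε) : ∃ B ∈ shiftCylinders X n, ν.real (symmDiff Λ B) < ε := by
  obtain ⟨B, hB, hlt⟩ := exists_mem_measure_symmDiff_lt (ν.trim (shiftAlgebra_le n))
    (isSetAlgebra_shiftCylinders n) (generateFrom_shiftCylinders n) hΛ hε
  rw [trim_measurableSet_eq _ (hΛ.symmDiff (measurableSet_of_mem_shiftCylinders hB))] at hlt
  exact ⟨B, hB, by rwa [measureReal_def, ← ENNReal.lt_ofReal_iff_toReal_lt (measure_ne_top _ _)]⟩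

/-! ### Disintegrations -/

variable {κ : (ℕ → X) → Measure (ℕ → X)} {ρ : Measure (ℕ → X)}

theorem ae_eq_of_forall_setLIntegral_tail [IsProbabilityMeasure ρ] {f g : (ℕ → X) → ℝ≥0∞}
    (hf : Measurable[tailAlgebra X] f) (hg : Measurable[tailAlgebra X] g)
    (h : ∀ Λ, MeasurableSet[tailAlgebra X] Λ → ∫⁻ ξ in Λ, f ξ ∂ρ = ∫⁻ ξ in Λ, g ξ ∂ρ) :
    f =ᵐ[ρ] g := by
  refine ae_eq_of_ae_eq_trim (hm := tailAlgebra_le) ?_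
  refine ae_eq_of_forall_setLIntegral_eq_of_sigmaFinite hf hg fun Λ hΛ _ => ?_
  rw [restrict_trim tailAlgebra_le _ hΛ, lintegral_trim _ hf, lintegral_trim _ hg, h Λ hΛ]

/-- The trimmed measure composed with the kernel is the law of `(ξ, ξ)`; evaluate it on `Λ ×ˢ Δ`. -/
theorem isDisintegratedBy_condExpKernel [StandardBorelSpace (ℕ → X)] [IsProbabilityMeasure ρ] :
    IsDisintegratedBy ρ (condExpKernel ρ (tailAlgebra X)) := by
  intro Δ Λ hΔ hΛ
  have h := congrArg (fun ν => ν (Λ ×ˢ Δ))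
    (compProd_trim_condExpKernel (μ := ρ) (m := tailAlgebra X) tailAlgebra_le)
  rw [Measure.compProd_apply_prod hΛ hΔ, restrict_trim tailAlgebra_le _ hΛ,
    lintegral_trim _ (measurable_condExpKernel hΔ)] at h
  rw [h]
  exact @Measure.map_apply _ _ MeasurableSpace.pi ((tailAlgebra X).prod MeasurableSpace.pi) ρ _
    ((measurable_id'' tailAlgebra_le).prodMk measurable_id) _ (hΛ.prod hΔ)

/-- For each cylinder both densities have the same integrals over tail events; countably many null
sets are discarded. -/
theorem IsDisintegratedBy.ae_eq [Finite X] [IsProbabilityMeasure ρ]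
    {κ' : (ℕ → X) → Measure (ℕ → X)}
    (hp : ∀ ξ, IsProbabilityMeasure (κ ξ)) (hp' : ∀ ξ, IsProbabilityMeasure (κ' ξ))
    (hm : ∀ Δ : Set (ℕ → X), MeasurableSet Δ → Measurable[tailAlgebra X] fun ξ => κ ξ Δ)
    (hm' : ∀ Δ : Set (ℕ → X), MeasurableSet Δ → Measurable[tailAlgebra X] fun ξ => κ' ξ Δ)
    (h : IsDisintegratedBy ρ κ) (h' : IsDisintegratedBy ρ κ') : κ =ᵐ[ρ] κ' := by
  have : ∀ᵐ ξ ∂ρ, ∀ A ∈ shiftCylinders X 0, κ ξ A = κ' ξ A := by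
    rw [ae_ball_iff (countable_shiftCylinders 0)]
    intro A hA
    have hA' := measurableSet_of_mem_shiftCylinders' hA
    exact ae_eq_of_forall_setLIntegral_tail (hm A hA') (hm' A hA') fun Λ hΛ => by
      rw [h A Λ hA' hΛ, h' A Λ hA' hΛ]
  filter_upwards [this] with ξ hξ
  exact ext_of_shiftCylinders hξ

theorem measurable_of_measurable_tail
    (hm : ∀ Δ : Set (ℕ → X), MeasurableSet Δ → Measurable[tailAlgebra X] fun ξ => κ ξ Δ) :
    Measurable κ :=
  Measure.measurable_of_measurable_coe κ fun Δ hΔ => (hm Δ hΔ).mono tailAlgebra_le le_rfl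

theorem IsDisintegratedBy.bind_eq
    (hm : ∀ Δ : Set (ℕ → X), MeasurableSet Δ → Measurable[tailAlgebra X] fun ξ => κ ξ Δ)
    (h : IsDisintegratedBy ρ κ) : ρ.bind κ = ρ := by
  ext Δ hΔ
  rw [Measure.bind_apply hΔ (measurable_of_measurable_tail hm).aemeasurable, ← setLIntegral_univ,
    h Δ Set.univ hΔ MeasurableSet.univ, Set.univ_inter]

theorem IsDisintegratedBy.lintegral_lintegral
    (hm : ∀ Δ : Set (ℕ → X), MeasurableSet Δ → Measurable[tailAlgebra X] fun ξ => κ ξ Δ)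
    (h : IsDisintegratedBy ρ κ) {φ : (ℕ → X) → ℝ≥0∞} (hφ : AEMeasurable φ ρ) :
    ∫⁻ ξ, ∫⁻ η, φ η ∂κ ξ ∂ρ = ∫⁻ η, φ η ∂ρ := by
  have hb := h.bind_eq hm
  rw [← Measure.lintegral_bind (measurable_of_measurable_tail hm).aemeasurable (hb.symm ▸ hφ), hb]

/-- Disintegrating `Λᶜ` over `Λ` gives `ρ ∅ = 0`, so `κ ξ Λᶜ` vanishes almost everywhere on `Λ`; the
same holds with `Λᶜ` for `Λ`. -/
theorem IsDisintegratedBy.ae_apply_tail (hp : ∀ ξ, IsProbabilityMeasure (κ ξ))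
    (hm : ∀ Δ : Set (ℕ → X), MeasurableSet Δ → Measurable[tailAlgebra X] fun ξ => κ ξ Δ)
    (h : IsDisintegratedBy ρ κ) {Λ : Set (ℕ → X)} (hΛ : MeasurableSet[tailAlgebra X] Λ) :
    ∀ᵐ ξ ∂ρ, κ ξ Λ = Λ.indicator 1 ξ := by
  have key : ∀ T : Set (ℕ → X), MeasurableSet[tailAlgebra X] T →
      ∀ᵐ ξ ∂ρ, ξ ∈ T → κ ξ Tᶜ = 0 := by
    intro T hT
    have hT' := tailAlgebra_le _ hT
    have h0 := h Tᶜ T hT'.compl hT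
    rw [Set.inter_compl_self, measure_empty, lintegral_eq_zero_iff
      ((hm _ hT'.compl).mono tailAlgebra_le le_rfl)] at h0
    exact (ae_restrict_iff' hT').1 h0
  filter_upwards [key Λ hΛ, key Λᶜ hΛ.compl] with ξ h1 h2
  by_cases hξ : ξ ∈ Λ
  · rw [Set.indicator_of_mem hξ, Pi.one_apply]
    exact (prob_compl_eq_zero_iff (tailAlgebra_le _ hΛ)).1 (h1 hξ)
  · rw [Set.indicator_of_notMem hξ]
    simpa using h2 hξ

/-! ### Molecules -/

/-- The event that the conditional probability of `A` is at most `q`. -/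
def probLe (κ : (ℕ → X) → Measure (ℕ → X)) (A : Set (ℕ → X)) (q : ℚ) : Set (ℕ → X) :=
  {η | (κ η).real A ≤ q}

theorem measurableSet_probLe
    (hm : ∀ Δ : Set (ℕ → X), MeasurableSet Δ → Measurable[tailAlgebra X] fun ξ => κ ξ Δ)
    {A : Set (ℕ → X)} (hA : MeasurableSet A) (q : ℚ) :
    MeasurableSet[tailAlgebra X] (probLe κ A q) :=
  (hm A hA).ennreal_toReal measurableSet_Iic

/-- Rational thresholds on cylinders determine a probability measure. For finite `X` this makes a
molecule a countable intersection of tail events. -/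
theorem mem_molecule_iff (hp : ∀ ξ, IsProbabilityMeasure (κ ξ)) (ξ η : ℕ → X) :
    η ∈ molecule κ ξ ↔ ∀ A ∈ shiftCylinders X 0, ∀ q, η ∈ probLe κ A q ↔ ξ ∈ probLe κ A q := by
  constructor
  · intro h A _ q
    change κ ξ = κ η at h
    simp [probLe, h]
  · intro h
    refine ext_of_shiftCylinders_real fun A hA => ?_
    refine le_antisymm (le_of_forall_rat_lt_imp_le ?_) (le_of_forall_rat_lt_imp_le ?_)
    · intro q hq
      by_contra hc
      exact absurd ((h A hA q).1 (not_le.1 hc).le) (not_le.2 hq)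
    · intro q hq
      by_contra hc
      exact absurd ((h A hA q).2 (not_le.1 hc).le) (not_le.2 hq)

theorem measurableSet_molecule [Finite X] (hp : ∀ ξ, IsProbabilityMeasure (κ ξ))
    (hm : ∀ Δ : Set (ℕ → X), MeasurableSet Δ → Measurable[tailAlgebra X] fun ξ => κ ξ Δ)
    (ξ : ℕ → X) : MeasurableSet[tailAlgebra X] (molecule κ ξ) := by
  have : molecule κ ξ = ⋂ A ∈ shiftCylinders X 0, ⋂ q : ℚ,
      {η | η ∈ probLe κ A q ↔ ξ ∈ probLe κ A q} := by
    ext η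
    simp [mem_molecule_iff hp]
  rw [this]
  refine MeasurableSet.biInter (countable_shiftCylinders 0) fun A hA =>
    MeasurableSet.iInter fun q => ?_
  have hq := measurableSet_probLe hm (measurableSet_of_mem_shiftCylinders' hA) q
  by_cases hξ : ξ ∈ probLe κ A q
  · simp only [hξ, iff_true]
    exact hq
  · simp only [hξ, iff_false]
    exact hq.compl

/-- Replaces the molecule, which varies with `ξ`, by fixed countably many tail events, so that the
condition is measurable in `ξ` and can be checked almost surely. -/
theorem molecule_apply_eq_one_iff [Finite X] (hp : ∀ ξ, IsProbabilityMeasure (κ ξ))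
    (hm : ∀ Δ : Set (ℕ → X), MeasurableSet Δ → Measurable[tailAlgebra X] fun ξ => κ ξ Δ)
    (ξ : ℕ → X) : κ ξ (molecule κ ξ) = 1 ↔
      ∀ A ∈ shiftCylinders X 0, ∀ q, κ ξ (probLe κ A q) = (probLe κ A q).indicator 1 ξ := by
  have hmol := tailAlgebra_le _ (measurableSet_molecule hp hm ξ)
  rw [← mem_ae_iff_prob_eq_one hmol]
  constructor
  · intro h A hA q
    have hq := tailAlgebra_le _
      (measurableSet_probLe hm (measurableSet_of_mem_shiftCylinders' hA) q)
    by_cases hξ : ξ ∈ probLe κ A q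
    · rw [Set.indicator_of_mem hξ, Pi.one_apply, ← mem_ae_iff_prob_eq_one hq]
      filter_upwards [h] with η hη
      exact ((mem_molecule_iff hp ξ η).1 hη A hA q).2 hξ
    · rw [Set.indicator_of_notMem hξ, measure_eq_zero_iff_ae_notMem]
      filter_upwards [h] with η hη
      exact fun hc => hξ (((mem_molecule_iff hp ξ η).1 hη A hA q).1 hc)
  · intro h
    have : ∀ᵐ η ∂κ ξ, ∀ A ∈ shiftCylinders X 0, ∀ q, η ∈ probLe κ A q ↔ ξ ∈ probLe κ A q := by
      rw [ae_ball_iff (countable_shiftCylinders 0)]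
      intro A hA
      rw [ae_all_iff]
      intro q
      have hq := tailAlgebra_le _
        (measurableSet_probLe hm (measurableSet_of_mem_shiftCylinders' hA) q)
      have hv := h A hA q
      by_cases hξ : ξ ∈ probLe κ A q
      · rw [Set.indicator_of_mem hξ, Pi.one_apply, ← mem_ae_iff_prob_eq_one hq] at hv
        filter_upwards [hv] with η hη
        exact iff_of_true hη hξ
      · rw [Set.indicator_of_notMem hξ, measure_eq_zero_iff_ae_notMem] at hv
        filter_upwards [hv] with η hη
        exact iff_of_false hη hξ
    filter_upwards [this] with η hη
    exact (mem_molecule_iff hp ξ η).2 hη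

theorem IsDisintegratedBy.ae_molecule [Finite X] (hp : ∀ ξ, IsProbabilityMeasure (κ ξ))
    (hm : ∀ Δ : Set (ℕ → X), MeasurableSet Δ → Measurable[tailAlgebra X] fun ξ => κ ξ Δ)
    (h : IsDisintegratedBy ρ κ) : ∀ᵐ ξ ∂ρ, κ ξ (molecule κ ξ) = 1 := by
  have : ∀ᵐ ξ ∂ρ, ∀ A ∈ shiftCylinders X 0, ∀ q,
      κ ξ (probLe κ A q) = (probLe κ A q).indicator 1 ξ := by
    rw [ae_ball_iff (countable_shiftCylinders 0)]
    intro A hA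
    rw [ae_all_iff]
    exact fun q => h.ae_apply_tail hp hm
      (measurableSet_probLe hm (measurableSet_of_mem_shiftCylinders' hA) q)
  filter_upwards [this] with ξ hξ
  exact (molecule_apply_eq_one_iff hp hm ξ).2 hξ

theorem measurableSet_setOf_molecule_apply [Finite X] (hp : ∀ ξ, IsProbabilityMeasure (κ ξ))
    (hm : ∀ Δ : Set (ℕ → X), MeasurableSet Δ → Measurable[tailAlgebra X] fun ξ => κ ξ Δ) :
    MeasurableSet[tailAlgebra X] {ξ | κ ξ (molecule κ ξ) = 1} := by
  have : {ξ | κ ξ (molecule κ ξ) = 1} = ⋂ A ∈ shiftCylinders X 0, ⋂ q : ℚ,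
      {ξ | κ ξ (probLe κ A q) = (probLe κ A q).indicator 1 ξ} := by
    ext ξ
    simp [molecule_apply_eq_one_iff hp hm]
  rw [this]
  refine MeasurableSet.biInter (countable_shiftCylinders 0) fun A hA =>
    MeasurableSet.iInter fun q => ?_
  have hq := measurableSet_probLe hm (measurableSet_of_mem_shiftCylinders' hA) q
  let _ := tailAlgebra X
  exact measurableSet_eq_fun (hm _ (tailAlgebra_le _ hq)) (measurable_one.indicator hq)

/-! ### Tail triviality -/

/-- Every tail event has probability zero or one. -/
def IsTailTrivial (ν : Measure (ℕ → X)) : Prop :=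
  ∀ Λ : Set (ℕ → X), MeasurableSet[tailAlgebra X] Λ → ν Λ = 0 ∨ ν Λ = 1

/-- Every cylinder is asymptotically independent of the remote future, uniformly. -/
def IsTailMixing (ν : Measure (ℕ → X)) : Prop :=
  ∀ A ∈ shiftCylinders X 0, ∀ k : ℕ, ∃ n, ∀ B ∈ shiftCylinders X n,
    |ν.real (A ∩ B) - ν.real A * ν.real B| ≤ 1 / (k + 1)

/-- As in Kolmogorov's zero-one law: approximating `Λ` by remote cylinders makes it independent of
every cylinder, and approximating `Λ` by cylinders then makes it independent of itself. -/
theorem IsTailMixing.isTailTrivial {ν : Measure (ℕ → X)} [IsProbabilityMeasure ν]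
    (h : IsTailMixing ν) : IsTailTrivial ν := by
  intro Λ hΛ
  have hΛ' := tailAlgebra_le _ hΛ
  have hsd : ∀ A B C : Set (ℕ → X), symmDiff (A ∩ B) (A ∩ C) ⊆ symmDiff B C := by
    intro A B C η
    simp only [Set.mem_symmDiff, Set.mem_inter_iff]
    tauto
  have habs : ∀ {B C : Set (ℕ → X)}, MeasurableSet B → MeasurableSet C →
      |ν.real B - ν.real C| ≤ ν.real (symmDiff B C) := fun hB hC =>
    abs_measureReal_sub_le_measureReal_symmDiff hB.nullMeasurableSet hC.nullMeasurableSet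
  have hmul : ∀ {a b : ℝ} (T : Set (ℕ → X)), |ν.real T * a - ν.real T * b| ≤ |a - b| := by
    intro a b T
    rw [← mul_sub, abs_mul, abs_of_nonneg measureReal_nonneg]
    exact mul_le_of_le_one_left (abs_nonneg _) measureReal_le_one
  have h1 : ∀ A ∈ shiftCylinders X 0, ν.real (A ∩ Λ) = ν.real A * ν.real Λ := by
    intro A hA
    have hA' := measurableSet_of_mem_shiftCylinders' hA
    refine eq_of_forall_dist_le fun ε hε => ?_
    obtain ⟨k, hk⟩ := exists_nat_one_div_lt (show 0 < ε / 3 by positivity)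
    obtain ⟨n, hn⟩ := h A hA k
    obtain ⟨B, hB, hlt⟩ := exists_shiftCylinders_measureReal_symmDiff_lt ν
      (tailAlgebra_le_shiftAlgebra n _ hΛ) (show 0 < ε / 3 by positivity)
    have hB' := measurableSet_of_mem_shiftCylinders' hB
    have e1 := (habs (hA'.inter hΛ') (hA'.inter hB')).trans (measureReal_mono (hsd A Λ B))
    have e2 := (hmul (a := ν.real Λ) (b := ν.real B) A).trans (habs hΛ' hB')
    have e3 := hn B hB
    rw [Real.dist_eq]
    rw [abs_le] at *
    constructor <;> linarith [e1.1, e1.2, e2.1, e2.2, e3.1, e3.2]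
  have h2 : ν.real Λ = ν.real Λ * ν.real Λ := by
    refine eq_of_forall_dist_le fun ε hε => ?_
    obtain ⟨A, hA, hlt⟩ := exists_shiftCylinders_measureReal_symmDiff_lt ν
      (tailAlgebra_le_shiftAlgebra 0 _ hΛ) (show 0 < ε / 2 by positivity)
    have hA' := measurableSet_of_mem_shiftCylinders' hA
    have e1 := (habs (hΛ'.inter hΛ') (hΛ'.inter hA')).trans (measureReal_mono (hsd Λ Λ A))
    have e2 := (hmul (a := ν.real Λ) (b := ν.real A) Λ).trans (habs hΛ' hA')
    have e3 := h1 A hA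
    rw [Set.inter_comm, mul_comm] at e3
    rw [Set.inter_self, e3] at e1
    rw [Real.dist_eq]
    rw [abs_le] at *
    constructor <;> linarith [e1.1, e1.2, e2.1, e2.2]
  have h3 : ν.real Λ = 0 ∨ ν.real Λ = 1 := by
    have : ν.real Λ * (ν.real Λ - 1) = 0 := by linarith
    rcases mul_eq_zero.1 this with h | h
    · exact Or.inl h
    · exact Or.inr (by linarith)
  refine h3.imp (fun h => (measureReal_eq_zero_iff).1 h) fun h => ?_
  rw [← ofReal_measureReal (μ := ν) (s := Λ), h, ENNReal.ofReal_one]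

/-- Tower property: conditioning on `Σₙ` first takes the factor `1_B` out. -/
theorem ae_measureReal_inter_eq_setIntegral_condExp [StandardBorelSpace (ℕ → X)]
    (ρ : Measure (ℕ → X)) [IsProbabilityMeasure ρ] {A B : Set (ℕ → X)} {n : ℕ}
    (hA : MeasurableSet A) (hB : MeasurableSet[shiftAlgebra X n] B) :
    ∀ᵐ ξ ∂ρ, (condExpKernel ρ (tailAlgebra X) ξ).real (A ∩ B) =
      ∫ η in B, (ρ[A.indicator (fun _ => (1 : ℝ)) | shiftAlgebra X n]) η
        ∂condExpKernel ρ (tailAlgebra X) ξ := by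
  have hB' : MeasurableSet B := shiftAlgebra_le n _ hB
  have hint : Integrable (A.indicator fun _ => (1 : ℝ)) ρ := (integrable_const _).indicator hA
  have e1 := condExpKernel_ae_eq_condExp (μ := ρ) tailAlgebra_le (hA.inter hB')
  have e2 := condExp_condExp_of_le (μ := ρ) (f := (A ∩ B).indicator fun _ => (1 : ℝ))
    (tailAlgebra_le_shiftAlgebra (X := X) n) (shiftAlgebra_le n)
  have e3 : ρ[(A ∩ B).indicator (fun _ => (1 : ℝ)) | shiftAlgebra X n] =ᵐ[ρ]
      B.indicator (ρ[A.indicator (fun _ => (1 : ℝ)) | shiftAlgebra X n]) := by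
    rw [Set.inter_comm, ← Set.indicator_indicator]
    exact condExp_indicator hint hB
  have e4 := condExp_congr_ae (m := tailAlgebra X) e3
  have e5 := condExp_ae_eq_integral_condExpKernel (μ := ρ) (m := tailAlgebra X) tailAlgebra_le
    ((integrable_condExp (μ := ρ) (m := shiftAlgebra X n)
      (f := A.indicator fun _ => (1 : ℝ))).indicator hB')
  filter_upwards [e1, e2, e4, e5] with ξ h1 h2 h4 h5
  rw [h1, ← h2, h4, h5, integral_indicator hB']

theorem ae_forall_exists_abs_sub_le [Finite X] [StandardBorelSpace (ℕ → X)]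
    (ρ : Measure (ℕ → X)) [IsProbabilityMeasure ρ] {A : Set (ℕ → X)}
    (hA : MeasurableSet A) : ∀ᵐ ξ ∂ρ, ∀ k : ℕ, ∃ n, ∀ B ∈ shiftCylinders X n,
      |(condExpKernel ρ (tailAlgebra X) ξ).real (A ∩ B) -
        (condExpKernel ρ (tailAlgebra X) ξ).real A *
          (condExpKernel ρ (tailAlgebra X) ξ).real B| ≤ 1 / (k + 1) := by
  set κ := condExpKernel ρ (tailAlgebra X) with hκ
  have hp : ∀ ξ, IsProbabilityMeasure (κ ξ) := fun ξ => inferInstance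
  have hm : ∀ Δ : Set (ℕ → X), MeasurableSet Δ → Measurable[tailAlgebra X] fun ξ => κ ξ Δ :=
    fun Δ hΔ => measurable_condExpKernel hΔ
  have hdis : IsDisintegratedBy ρ κ := isDisintegratedBy_condExpKernel
  let f : ℕ → (ℕ → X) → ℝ := fun n => ρ[A.indicator (fun _ => (1 : ℝ)) | shiftAlgebra X n]
  let g : (ℕ → X) → ℝ := fun η => (κ η).real A
  have hf : ∀ n, Measurable (f n) := fun n =>
    (stronglyMeasurable_condExp.mono (shiftAlgebra_le n)).measurable
  have hg : Measurable g := ((hm A hA).mono tailAlgebra_le le_rfl).ennreal_toReal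
  have hfg : ∀ n, Measurable fun η => ‖f n η - g η‖ₑ := fun n => ((hf n).sub hg).enorm
  -- Since `ρ` is the average of the `κ ξ`, the double integral is the `L¹(ρ)` distance in Lévy's
  -- theorem.
  have hlim : Tendsto (fun n => ∫⁻ ξ, ∫⁻ η, ‖f n η - g η‖ₑ ∂κ ξ ∂ρ) atTop (𝓝 0) := by
    have hL2 : MemLp (A.indicator fun _ => (1 : ℝ)) 2 ρ := (memLp_const _).indicator hA
    refine (tendsto_eLpNorm_condExp_iInf ρ (antitone_shiftAlgebra (X := X)) shiftAlgebra_le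
      hL2).congr fun n => ?_
    rw [hdis.lintegral_lintegral hm (hfg n).aemeasurable, eLpNorm_one_eq_lintegral_enorm]
    refine lintegral_congr_ae ?_
    filter_upwards [condExpKernel_ae_eq_condExp (μ := ρ) tailAlgebra_le hA] with ξ hξ
    simp only [Pi.sub_apply, f, g]
    rw [hκ, hξ]
  -- Fatou gives only a vanishing `liminf`, which suffices: one `n` is needed for each `k`.
  have hliminf : ∀ᵐ ξ ∂ρ, liminf (fun n => ∫⁻ η, ‖f n η - g η‖ₑ ∂κ ξ) atTop = 0 := by
    have hmeas : ∀ n, Measurable fun ξ => ∫⁻ η, ‖f n η - g η‖ₑ ∂κ ξ := fun n =>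
      (Measure.measurable_lintegral (hfg n)).comp (measurable_of_measurable_tail hm)
    have h0 := lintegral_liminf_le (u := atTop) (μ := ρ) hmeas
    rw [hlim.liminf_eq, nonpos_iff_eq_zero,
      lintegral_eq_zero_iff (Measurable.liminf hmeas)] at h0
    exact h0
  have heq : ∀ᵐ ξ ∂ρ, ∀ n, ∀ B ∈ shiftCylinders X n,
      (κ ξ).real (A ∩ B) = ∫ η in B, f n η ∂κ ξ := by
    rw [ae_all_iff]
    intro n
    rw [ae_ball_iff (countable_shiftCylinders n)]
    exact fun B hB => ae_measureReal_inter_eq_setIntegral_condExp ρ hA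
      (measurableSet_of_mem_shiftCylinders hB)
  have hint : ∀ᵐ ξ ∂ρ, ∀ n, Integrable (f n) (κ ξ) := by
    rw [ae_all_iff]
    exact fun n => (integrable_condExp (μ := ρ)).condExpKernel_ae
  filter_upwards [hliminf, heq, hint, hdis.ae_molecule hp hm] with ξ h1 h2 h3 h4 k
  have hk : (0 : ℝ) < 1 / (k + 1) := by positivity
  obtain ⟨n, hn⟩ := (frequently_lt_of_liminf_lt (by isBoundedDefault)
    (h1.trans_lt (ENNReal.ofReal_pos.2 hk))).exists
  refine ⟨n, fun B hB => ?_⟩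
  have hB' := measurableSet_of_mem_shiftCylinders' hB
  have hgξ : ∀ᵐ η ∂κ ξ, g η = (κ ξ).real A := by
    have hmol := tailAlgebra_le _ (measurableSet_molecule hp hm ξ)
    filter_upwards [(mem_ae_iff_prob_eq_one hmol).2 h4] with η hη
    change κ ξ = κ η at hη
    simp only [g, hη]
  have hgint : Integrable g (κ ξ) :=
    (integrable_const ((κ ξ).real A)).congr (hgξ.mono fun η h => h.symm)
  have hgB : ∫ η in B, g η ∂κ ξ = (κ ξ).real A * (κ ξ).real B := by
    rw [integral_congr_ae (ae_restrict_of_ae hgξ), setIntegral_const, smul_eq_mul, mul_comm]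
  -- The error is an integral over `B`, bounded by the integral of `‖f n - g‖ₑ` over all histories;
  -- hence the uniformity in `B`.
  rw [h2 n B hB, ← hgB, ← integral_sub (h3 n).integrableOn hgint.integrableOn]
  rw [← Real.norm_eq_abs, ← ENNReal.ofReal_le_ofReal_iff hk.le, ofReal_norm]
  exact (enorm_integral_le_lintegral_enorm _).trans ((setLIntegral_le_lintegral _ _).trans hn.le)

theorem ae_isTailMixing_condExpKernel [Finite X] [StandardBorelSpace (ℕ → X)]
    (ρ : Measure (ℕ → X)) [IsProbabilityMeasure ρ] :
    ∀ᵐ ξ ∂ρ, IsTailMixing (condExpKernel ρ (tailAlgebra X) ξ) := by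
  simp only [IsTailMixing]
  rw [ae_ball_iff (countable_shiftCylinders 0)]
  exact fun A hA => ae_forall_exists_abs_sub_le ρ (measurableSet_of_mem_shiftCylinders' hA)

theorem IsDisintegratedBy.ae_isTailMixing [Finite X] [StandardBorelSpace (ℕ → X)]
    [IsProbabilityMeasure ρ] (hp : ∀ ξ, IsProbabilityMeasure (κ ξ))
    (hm : ∀ Δ : Set (ℕ → X), MeasurableSet Δ → Measurable[tailAlgebra X] fun ξ => κ ξ Δ)
    (h : IsDisintegratedBy ρ κ) : ∀ᵐ ξ ∂ρ, IsTailMixing (κ ξ) := by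
  filter_upwards [ae_isTailMixing_condExpKernel ρ,
    h.ae_eq hp (fun _ => inferInstance) hm (fun _ hΔ => measurable_condExpKernel hΔ)
      isDisintegratedBy_condExpKernel] with ξ h1 h2
  rwa [h2]

/-- Makes a tail-trivial measure its own conditional law, so that statements on disintegrations
apply to it. -/
theorem IsTailTrivial.isDisintegratedBy_const {ν : Measure (ℕ → X)} [IsProbabilityMeasure ν]
    (h : IsTailTrivial ν) : IsDisintegratedBy ν fun _ => ν := by
  intro Δ Λ hΔ hΛ
  rw [setLIntegral_const]
  rcases h Λ hΛ with h0 | h1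
  · rw [h0, mul_zero, measure_mono_null Set.inter_subset_left h0]
  · rw [h1, mul_one, Set.inter_comm]
    have := (prob_compl_eq_zero_iff (tailAlgebra_le _ hΛ)).2 h1
    exact (measure_inter_conull this).symm

/-- For the converse, almost every member of the constant family `ν` is mixing, hence `ν` is. -/
theorem isTailMixing_iff_isTailTrivial [Finite X] [StandardBorelSpace (ℕ → X)]
    {ν : Measure (ℕ → X)} [IsProbabilityMeasure ν] : IsTailMixing ν ↔ IsTailTrivial ν := by
  refine ⟨fun h => h.isTailTrivial, fun h => ?_⟩
  obtain ⟨ξ, hξ⟩ := (h.isDisintegratedBy_const.ae_isTailMixing (fun _ => inferInstance)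
    fun Δ _ => measurable_const).exists
  exact hξ

/-- Tail triviality quantifies over uncountably many events, mixing only over countably many; this
is why mixing is introduced. -/
theorem measurableSet_setOf_isTailMixing [Finite X]
    (hm : ∀ Δ : Set (ℕ → X), MeasurableSet Δ → Measurable[tailAlgebra X] fun ξ => κ ξ Δ) :
    MeasurableSet[tailAlgebra X] {ξ | IsTailMixing (κ ξ)} := by
  have hr : ∀ Δ : Set (ℕ → X), MeasurableSet Δ →
      Measurable[tailAlgebra X] fun ξ => (κ ξ).real Δ := fun Δ hΔ => (hm Δ hΔ).ennreal_toReal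
  have : {ξ | IsTailMixing (κ ξ)} = ⋂ A ∈ shiftCylinders X 0, ⋂ k : ℕ, ⋃ n,
      ⋂ B ∈ shiftCylinders X n,
        {ξ | |(κ ξ).real (A ∩ B) - (κ ξ).real A * (κ ξ).real B| ≤ 1 / (k + 1)} := by
    ext ξ
    simp [IsTailMixing]
  rw [this]
  refine MeasurableSet.biInter (countable_shiftCylinders 0) fun A hA =>
    MeasurableSet.iInter fun k => MeasurableSet.iUnion fun n =>
      MeasurableSet.biInter (countable_shiftCylinders n) fun B hB => ?_
  have hA' := measurableSet_of_mem_shiftCylinders' hA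
  have hB' := measurableSet_of_mem_shiftCylinders' hB
  have h1 := hr _ (hA'.inter hB')
  have h2 := hr _ hA'
  have h3 := hr _ hB'
  let _ := tailAlgebra X
  exact measurableSet_le (h1.sub (h2.mul h3)).abs measurable_const

/-! ### The set of regular histories -/

theorem ae_eq_of_molecule_apply [Finite X] (hp : ∀ ξ, IsProbabilityMeasure (κ ξ))
    (hm : ∀ Δ : Set (ℕ → X), MeasurableSet Δ → Measurable[tailAlgebra X] fun ξ => κ ξ Δ)
    {ξ : ℕ → X} (h : κ ξ (molecule κ ξ) = 1) : ∀ᵐ η ∂κ ξ, κ ξ = κ η :=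
  (mem_ae_iff_prob_eq_one (tailAlgebra_le _ (measurableSet_molecule hp hm ξ))).2 h

/-- Here `κ` is `κ ξ`-almost surely constant, so disintegration says that tail events are
independent of all events, in particular of themselves. -/
theorem isDisintegratedBy_iff_isTailTrivial [Finite X] (hp : ∀ ξ, IsProbabilityMeasure (κ ξ))
    (hm : ∀ Δ : Set (ℕ → X), MeasurableSet Δ → Measurable[tailAlgebra X] fun ξ => κ ξ Δ)
    {ξ : ℕ → X} (h : κ ξ (molecule κ ξ) = 1) :
    IsDisintegratedBy (κ ξ) κ ↔ IsTailTrivial (κ ξ) := by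
  have hconst : ∀ Δ Λ : Set (ℕ → X),
      ∫⁻ η in Λ, κ η Δ ∂κ ξ = ∫⁻ η in Λ, κ ξ Δ ∂κ ξ := fun Δ Λ =>
    lintegral_congr_ae (ae_restrict_of_ae
      ((ae_eq_of_molecule_apply hp hm h).mono fun η hη => by simp only [hη]))
  constructor
  · intro hd Λ hΛ
    have h1 := hd Λ Λ (tailAlgebra_le _ hΛ) hΛ
    rw [hconst, setLIntegral_const, Set.inter_self] at h1
    by_cases h0 : κ ξ Λ = 0
    · exact Or.inl h0
    · exact Or.inr ((ENNReal.mul_eq_right h0 (measure_ne_top _ _)).1 h1)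
  · intro ht Δ Λ hΔ hΛ
    rw [hconst]
    exact ht.isDisintegratedBy_const Δ Λ hΔ hΛ

theorem regularSet_eq [Finite X] [StandardBorelSpace (ℕ → X)]
    (hp : ∀ ξ, IsProbabilityMeasure (κ ξ))
    (hm : ∀ Δ : Set (ℕ → X), MeasurableSet Δ → Measurable[tailAlgebra X] fun ξ => κ ξ Δ) :
    regularSet κ = {ξ | κ ξ (molecule κ ξ) = 1} ∩ {ξ | IsTailMixing (κ ξ)} := by
  ext ξ
  simp only [regularSet, Set.mem_inter_iff, Set.mem_ofPred_eq, isTailMixing_iff_isTailTrivial]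
  exact ⟨fun h => ⟨h.2, (isDisintegratedBy_iff_isTailTrivial hp hm h.2).1 h.1⟩,
    fun h => ⟨(isDisintegratedBy_iff_isTailTrivial hp hm h.1).2 h.2, h.1⟩⟩

theorem measurableSet_regularSet [Finite X] [StandardBorelSpace (ℕ → X)]
    (hp : ∀ ξ, IsProbabilityMeasure (κ ξ))
    (hm : ∀ Δ : Set (ℕ → X), MeasurableSet Δ → Measurable[tailAlgebra X] fun ξ => κ ξ Δ) :
    MeasurableSet[tailAlgebra X] (regularSet κ) := by
  rw [regularSet_eq hp hm]
  exact (measurableSet_setOf_molecule_apply hp hm).inter (measurableSet_setOf_isTailMixing hm)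

theorem IsDisintegratedBy.ae_mem_regularSet [Finite X] [StandardBorelSpace (ℕ → X)]
    [IsProbabilityMeasure ρ] (hp : ∀ ξ, IsProbabilityMeasure (κ ξ))
    (hm : ∀ Δ : Set (ℕ → X), MeasurableSet Δ → Measurable[tailAlgebra X] fun ξ => κ ξ Δ)
    (h : IsDisintegratedBy ρ κ) : ∀ᵐ ξ ∂ρ, ξ ∈ regularSet κ := by
  rw [regularSet_eq hp hm]
  filter_upwards [h.ae_molecule hp hm, h.ae_isTailMixing hp hm] with ξ h1 h2
  exact ⟨h1, h2⟩

theorem exists_isErgodicDisintegration [Finite X] [StandardBorelSpace (ℕ → X)]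
    (μ : Measure (ℕ → X)) [IsProbabilityMeasure μ] :
    ∃ κ : (ℕ → X) → Measure (ℕ → X), IsErgodicDisintegration μ κ :=
  ⟨condExpKernel μ (tailAlgebra X), fun _ => inferInstance,
    fun _ hΔ => measurable_condExpKernel hΔ, isDisintegratedBy_condExpKernel, by
      filter_upwards [ae_isTailMixing_condExpKernel μ] with ξ hξ
      exact hξ.isTailTrivial⟩

end Tail

/-! ### The space of molecules and the Choquet decomposition -/

section Molecules

variable {X : Type*} [MeasurableSpace X] {κ : (ℕ → X) → Measure (ℕ → X)} {ρ : Measure (ℕ → X)}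

/-- The quotient map `p`. -/
def toMolecule (κ : (ℕ → X) → Measure (ℕ → X)) (ξ : regularSet κ) : MoleculeSpace κ :=
  Quotient.mk (moleculeSetoid κ) ξ

theorem preimageMol_eq (E : Set (MoleculeSpace κ)) :
    preimageMol κ E = Subtype.val '' (toMolecule κ ⁻¹' E) := rfl

theorem mem_preimageMol {E : Set (MoleculeSpace κ)} {ξ : ℕ → X} :
    ξ ∈ preimageMol κ E ↔ ∃ h : ξ ∈ regularSet κ, toMolecule κ ⟨ξ, h⟩ ∈ E := by
  simp [preimageMol_eq]

theorem surjective_toMolecule : Function.Surjective (toMolecule κ) := Quotient.mk_surjective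

theorem toMolecule_eq_iff {ξ η : regularSet κ} : toMolecule κ ξ = toMolecule κ η ↔ κ ξ = κ η :=
  Quotient.eq (r := moleculeSetoid κ)

@[simp] theorem molMeasure_toMolecule (ξ : regularSet κ) : molMeasure κ (toMolecule κ ξ) = κ ξ := rfl

theorem preimageMol_univ : preimageMol κ Set.univ = regularSet κ := by
  simp [preimageMol_eq]

theorem preimageMol_compl (E : Set (MoleculeSpace κ)) :
    preimageMol κ Eᶜ = regularSet κ \ preimageMol κ E := by
  ext ξ
  simp only [mem_preimageMol, Set.mem_sdiff, Set.mem_compl_iff, not_exists]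
  exact ⟨fun ⟨h, h'⟩ => ⟨h, fun _ => h'⟩, fun ⟨h, h'⟩ => ⟨h, h' h⟩⟩

theorem preimageMol_iUnion {ι : Type*} (E : ι → Set (MoleculeSpace κ)) :
    preimageMol κ (⋃ i, E i) = ⋃ i, preimageMol κ (E i) := by
  simp [preimageMol_eq, Set.image_iUnion]

/-- The sets of molecules with preimage in `Σ_∞` form a σ-algebra. -/
theorem measurableSet_moleculeSpace_iff (hreg : MeasurableSet[tailAlgebra X] (regularSet κ))
    {E : Set (MoleculeSpace κ)} :
    MeasurableSet E ↔ MeasurableSet[tailAlgebra X] (preimageMol κ E) := by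
  refine ⟨fun h => ?_, fun h => MeasurableSpace.measurableSet_generateFrom h⟩
  induction E, h using MeasurableSpace.generateFrom_induction with
  | hC E hE _ => exact hE
  | empty => simp [preimageMol_eq]
  | compl E _ ih =>
    -- The complement is taken inside `regularSet κ`, which must therefore be a tail event.
    rw [preimageMol_compl]
    exact hreg.diff ih
  | iUnion E _ ih =>
    rw [preimageMol_iUnion]
    exact MeasurableSet.iUnion ih

theorem measurable_toMolecule (hreg : MeasurableSet[tailAlgebra X] (regularSet κ)) :
    Measurable (toMolecule κ) := by
  intro E hE
  have h := tailAlgebra_le _ ((measurableSet_moleculeSpace_iff hreg).1 hE)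
  have := measurable_subtype_coe (p := (· ∈ regularSet κ)) h
  rwa [preimageMol_eq, Set.preimage_image_eq _ Subtype.val_injective] at this

theorem measurable_molMeasure_apply (hreg : MeasurableSet[tailAlgebra X] (regularSet κ))
    (hm : ∀ Δ : Set (ℕ → X), MeasurableSet Δ → Measurable[tailAlgebra X] fun ξ => κ ξ Δ)
    {Δ : Set (ℕ → X)} (hΔ : MeasurableSet Δ) : Measurable fun ν => molMeasure κ ν Δ := by
  intro T hT
  rw [measurableSet_moleculeSpace_iff hreg]
  have : preimageMol κ ((fun ν => molMeasure κ ν Δ) ⁻¹' T) =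
      regularSet κ ∩ (fun ξ => κ ξ Δ) ⁻¹' T := by
    ext ξ
    simp [mem_preimageMol]
  rw [this]
  exact hreg.inter (hm Δ hΔ hT)

theorem isImage_map_comap (hreg : MeasurableSet[tailAlgebra X] (regularSet κ)) :
    IsImage ρ κ ((ρ.comap Subtype.val).map (toMolecule κ)) := by
  intro E hE
  rw [Measure.map_apply (measurable_toMolecule hreg) hE,
    comap_subtype_coe_apply (tailAlgebra_le _ hreg), preimageMol_eq]

theorem IsImage.eq {P Q : Measure (MoleculeSpace κ)} (hP : IsImage ρ κ P) (hQ : IsImage ρ κ Q) :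
    P = Q :=
  Measure.ext fun E hE => by rw [hP E hE, hQ E hE]

theorem IsImage.setLIntegral_eq {P : Measure (MoleculeSpace κ)} (hP : IsImage ρ κ P)
    (hreg : MeasurableSet[tailAlgebra X] (regularSet κ))
    {F : MoleculeSpace κ → ℝ≥0∞} (hF : Measurable F) {G : (ℕ → X) → ℝ≥0∞}
    (hFG : ∀ ξ, F (toMolecule κ ξ) = G ξ)
    {E : Set (MoleculeSpace κ)} (hE : MeasurableSet E) :
    ∫⁻ ν in E, F ν ∂P = ∫⁻ ξ in preimageMol κ E, G ξ ∂ρ := by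
  rw [hP.eq (isImage_map_comap hreg), setLIntegral_map hE hF (measurable_toMolecule hreg),
    preimageMol_eq, ← setLIntegral_subtype (tailAlgebra_le _ hreg)]
  simp only [hFG]

theorem mem_regularSet_of_mem_molecule {ξ η : ℕ → X} (hξ : ξ ∈ regularSet κ)
    (hη : η ∈ molecule κ ξ) : η ∈ regularSet κ := by
  change κ ξ = κ η at hη
  simpa [regularSet, molecule, hη] using hξ

/-- The measure `μ(· | ν)` is carried by the molecule `ν`. -/
theorem molMeasure_preimageMol [Finite X] (hp : ∀ ξ, IsProbabilityMeasure (κ ξ))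
    (hm : ∀ Δ : Set (ℕ → X), MeasurableSet Δ → Measurable[tailAlgebra X] fun ξ => κ ξ Δ)
    (hreg : MeasurableSet[tailAlgebra X] (regularSet κ))
    {E : Set (MoleculeSpace κ)} (hE : MeasurableSet E) (ν : MoleculeSpace κ) :
    molMeasure κ ν (preimageMol κ E) = E.indicator 1 ν := by
  obtain ⟨⟨ξ, hξ⟩, rfl⟩ := surjective_toMolecule ν
  rw [molMeasure_toMolecule]
  have hE' := tailAlgebra_le _ ((measurableSet_moleculeSpace_iff hreg).1 hE)
  have hae := ae_eq_of_molecule_apply hp hm hξ.2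
  have hsame : ∀ η, κ ξ = κ η → (η ∈ preimageMol κ E ↔ toMolecule κ ⟨ξ, hξ⟩ ∈ E) := by
    intro η hη
    have hηr := mem_regularSet_of_mem_molecule hξ hη
    have : toMolecule κ ⟨ξ, hξ⟩ = toMolecule κ ⟨η, hηr⟩ := toMolecule_eq_iff.2 hη
    rw [this, mem_preimageMol]
    exact ⟨fun ⟨_, h⟩ => h, fun h => ⟨hηr, h⟩⟩
  by_cases h : toMolecule κ ⟨ξ, hξ⟩ ∈ E
  · rw [Set.indicator_of_mem h, Pi.one_apply, ← mem_ae_iff_prob_eq_one hE']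
    filter_upwards [hae] with η hη
    exact (hsame η hη).2 h
  · rw [Set.indicator_of_notMem h, measure_eq_zero_iff_ae_notMem]
    filter_upwards [hae] with η hη
    exact fun hc => h ((hsame η hη).1 hc)

/-- Each `μ(· | ν)` gives a union of molecules mass `0` or `1`, so the mixture's value there is the
mass of `Q`. This yields uniqueness of the mixing measure. -/
theorem IsMixture.isImage [Finite X] (hp : ∀ ξ, IsProbabilityMeasure (κ ξ))
    (hm : ∀ Δ : Set (ℕ → X), MeasurableSet Δ → Measurable[tailAlgebra X] fun ξ => κ ξ Δ)
    (hreg : MeasurableSet[tailAlgebra X] (regularSet κ))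
    {Q : Measure (MoleculeSpace κ)} (hQ : IsMixture ρ κ Q) : IsImage ρ κ Q := by
  intro E hE
  rw [hQ _ (tailAlgebra_le _ ((measurableSet_moleculeSpace_iff hreg).1 hE))]
  simp only [molMeasure_preimageMol hp hm hreg hE]
  rw [lintegral_indicator_one hE]

theorem IsDisintegratedBy.setLIntegral_molMeasure
    (hm : ∀ Δ : Set (ℕ → X), MeasurableSet Δ → Measurable[tailAlgebra X] fun ξ => κ ξ Δ)
    (hreg : MeasurableSet[tailAlgebra X] (regularSet κ)) (h : IsDisintegratedBy ρ κ)
    {P : Measure (MoleculeSpace κ)} (hP : IsImage ρ κ P)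
    {Δ : Set (ℕ → X)} {E : Set (MoleculeSpace κ)} (hΔ : MeasurableSet Δ) (hE : MeasurableSet E) :
    ∫⁻ ν in E, molMeasure κ ν Δ ∂P = ρ (preimageMol κ E ∩ Δ) := by
  rw [hP.setLIntegral_eq hreg (measurable_molMeasure_apply hreg hm hΔ) (G := fun ξ => κ ξ Δ)
    (fun _ => rfl) hE, h Δ _ hΔ ((measurableSet_moleculeSpace_iff hreg).1 hE)]

theorem IsDisintegratedBy.exists_isImage [Finite X] [StandardBorelSpace (ℕ → X)]
    [IsProbabilityMeasure ρ] (hp : ∀ ξ, IsProbabilityMeasure (κ ξ))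
    (hm : ∀ Δ : Set (ℕ → X), MeasurableSet Δ → Measurable[tailAlgebra X] fun ξ => κ ξ Δ)
    (h : IsDisintegratedBy ρ κ) :
    ∃ P : Measure (MoleculeSpace κ), IsProbabilityMeasure P ∧ IsImage ρ κ P := by
  have hreg := measurableSet_regularSet hp hm
  refine ⟨_, ⟨?_⟩, isImage_map_comap hreg⟩
  rw [isImage_map_comap hreg _ MeasurableSet.univ, preimageMol_univ,
    ← mem_ae_iff_prob_eq_one (tailAlgebra_le _ hreg)]
  exact h.ae_mem_regularSet hp hm

theorem IsDisintegratedBy.isMolDisintegrated [Finite X] [StandardBorelSpace (ℕ → X)]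
    [IsProbabilityMeasure ρ] (hp : ∀ ξ, IsProbabilityMeasure (κ ξ))
    (hm : ∀ Δ : Set (ℕ → X), MeasurableSet Δ → Measurable[tailAlgebra X] fun ξ => κ ξ Δ)
    (h : IsDisintegratedBy ρ κ) : IsMolDisintegrated ρ κ := by
  obtain ⟨P, hP, hPi⟩ := h.exists_isImage hp hm
  exact ⟨P, hP, hPi, fun Δ E hΔ hE =>
    h.setLIntegral_molMeasure hm (measurableSet_regularSet hp hm) hPi hΔ hE⟩

/-- A tail event need not be a union of molecules, so the hypothesis only provides `ρ = ∫ κ ξ dρ`.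
But each regular `κ ξ` is itself disintegrated by `κ`, and integrating these identities covers all
tail events. -/
theorem IsMolDisintegrated.isDisintegratedBy [Finite X] [StandardBorelSpace (ℕ → X)]
    [IsProbabilityMeasure ρ] (hp : ∀ ξ, IsProbabilityMeasure (κ ξ))
    (hm : ∀ Δ : Set (ℕ → X), MeasurableSet Δ → Measurable[tailAlgebra X] fun ξ => κ ξ Δ)
    (h : IsMolDisintegrated ρ κ) : IsDisintegratedBy ρ κ := by
  have hreg := measurableSet_regularSet hp hm
  obtain ⟨P, hP, hPi, hd⟩ := h
  have hae : ∀ᵐ ξ ∂ρ, ξ ∈ regularSet κ := by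
    have h1 := hPi _ MeasurableSet.univ
    rw [measure_univ, preimageMol_univ] at h1
    exact (mem_ae_iff_prob_eq_one (tailAlgebra_le _ hreg)).2 h1.symm
  have hmeas := measurable_of_measurable_tail hm
  have hlint : ∀ Δ : Set (ℕ → X), MeasurableSet Δ → ∫⁻ ξ, κ ξ Δ ∂ρ = ρ Δ := by
    intro Δ hΔ
    have h1 := hd Δ Set.univ hΔ MeasurableSet.univ
    rw [hPi.setLIntegral_eq hreg (measurable_molMeasure_apply hreg hm hΔ) (G := fun ξ => κ ξ Δ)
      (fun _ => rfl) MeasurableSet.univ, preimageMol_univ, Measure.restrict_eq_self_of_ae_mem hae,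
      Set.inter_comm, measure_inter_conull (t := regularSet κ) (mem_ae_iff.1 hae)] at h1
    exact h1
  have hbind : ρ.bind κ = ρ := by
    ext Δ hΔ
    rw [Measure.bind_apply hΔ hmeas.aemeasurable, hlint Δ hΔ]
  intro Δ Λ hΔ hΛ
  have hΛ' := tailAlgebra_le _ hΛ
  have hκΔ : Measurable fun η => κ η Δ := (hm Δ hΔ).mono tailAlgebra_le le_rfl
  calc ∫⁻ η in Λ, κ η Δ ∂ρ
      = ∫⁻ η, Λ.indicator (fun η => κ η Δ) η ∂(ρ.bind κ) := by
        rw [hbind, lintegral_indicator hΛ']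
    _ = ∫⁻ ξ, ∫⁻ η in Λ, κ η Δ ∂κ ξ ∂ρ := by
        rw [Measure.lintegral_bind hmeas.aemeasurable (hκΔ.indicator hΛ').aemeasurable]
        simp only [lintegral_indicator hΛ']
    _ = ∫⁻ ξ, κ ξ (Λ ∩ Δ) ∂ρ := by
        refine lintegral_congr_ae ?_
        filter_upwards [hae] with ξ hξ
        exact hξ.1 Δ Λ hΔ hΛ
    _ = ρ (Λ ∩ Δ) := hlint _ (hΛ'.inter hΔ)

/-! ### Convexity and extreme points -/

theorem convex_disintegratedSet [TopologicalSpace X]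
    (hRegular : ∀ ρ : Measure (ℕ → X), IsProbabilityMeasure ρ → ρ.Regular) :
    Convex ℝ≥0 (disintegratedSet κ) := by
  rintro ρ₁ ⟨h₁, -, hd₁⟩ ρ₂ ⟨h₂, -, hd₂⟩ a b - - hab
  have hprob : IsProbabilityMeasure (a • ρ₁ + b • ρ₂) :=
    ⟨by
      rw [Measure.add_apply, Measure.smul_apply, Measure.smul_apply, measure_univ, measure_univ,
        ENNReal.smul_def, ENNReal.smul_def, smul_eq_mul, smul_eq_mul, mul_one, mul_one,
        ← ENNReal.coe_add, hab, ENNReal.coe_one]⟩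
  refine ⟨hprob, hRegular _ hprob, fun Δ Λ hΔ hΛ => ?_⟩
  simp only [Measure.restrict_add, Measure.restrict_smul, lintegral_add_measure,
    lintegral_smul_measure, Measure.add_apply, Measure.smul_apply, hd₁ Δ Λ hΔ hΛ, hd₂ Δ Λ hΔ hΛ]

theorem IsDisintegratedBy.cond (h : IsDisintegratedBy ρ κ) {Λ : Set (ℕ → X)}
    (hΛ : MeasurableSet[tailAlgebra X] Λ) : IsDisintegratedBy (ρ[|Λ]) κ := by
  intro Δ Λ' hΔ hΛ'
  rw [ProbabilityTheory.cond, Measure.restrict_smul, lintegral_smul_measure, Measure.smul_apply,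
    Measure.restrict_restrict (tailAlgebra_le _ hΛ'), h Δ _ hΔ (hΛ'.inter hΛ),
    Measure.restrict_apply ((tailAlgebra_le _ hΛ').inter hΔ), Set.inter_right_comm]

/-- If `0 < ρ Λ < 1`, then `ρ` is a proper convex combination of its conditionings on `Λ` and `Λᶜ`,
both in `𝓚`; extremality gives `ρ[|Λ] = ρ`, which forces `ρ Λ = 1`. -/
theorem isTailTrivial_of_mem_extremePoints [TopologicalSpace X]
    (hRegular : ∀ ρ : Measure (ℕ → X), IsProbabilityMeasure ρ → ρ.Regular)
    (h : ρ ∈ Set.extremePoints ℝ≥0 (disintegratedSet κ)) : IsTailTrivial ρ := by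
  obtain ⟨⟨hprob, -, hd⟩, hext⟩ := h
  intro Λ hΛ
  by_contra! hne
  have hΛ' := tailAlgebra_le _ hΛ
  have hc : ρ Λᶜ ≠ 0 := fun h0 => hne.2 ((prob_compl_eq_zero_iff hΛ').1 h0)
  have hp1 := cond_isProbabilityMeasure hne.1
  have hp2 := cond_isProbabilityMeasure hc
  have heq : ρ[|Λ] = ρ := by
    refine hext ⟨hp1, hRegular _ hp1, hd.cond hΛ⟩ ⟨hp2, hRegular _ hp2, hd.cond hΛ.compl⟩
      ⟨(ρ Λ).toNNReal, (ρ Λᶜ).toNNReal, ?_, ?_, ?_, ?_⟩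
    · exact ENNReal.toNNReal_pos hne.1 (measure_ne_top _ _)
    · exact ENNReal.toNNReal_pos hc (measure_ne_top _ _)
    · rw [← ENNReal.toNNReal_add (measure_ne_top _ _) (measure_ne_top _ _),
        measure_add_measure_compl hΛ', measure_univ, ENNReal.toNNReal_one]
    · ext Δ hΔ
      simp only [Measure.add_apply, Measure.smul_apply, ENNReal.smul_def,
        ENNReal.coe_toNNReal (measure_ne_top _ _), smul_eq_mul]
      rw [mul_comm, cond_mul_eq_inter hΛ', mul_comm, cond_mul_eq_inter hΛ'.compl,
        Set.inter_comm, Set.inter_comm Λᶜ, ← Set.sdiff_eq, measure_inter_add_sdiff Δ hΛ']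
  have h1 := cond_apply_self (μ := ρ) (s := Λ) hne.1 (measure_ne_top _ _)
  rw [heq] at h1
  exact hne.2 h1

theorem extremePoints_disintegratedSet [Finite X] [StandardBorelSpace (ℕ → X)]
    [TopologicalSpace X]
    (hRegular : ∀ ρ : Measure (ℕ → X), IsProbabilityMeasure ρ → ρ.Regular)
    (hp : ∀ ξ, IsProbabilityMeasure (κ ξ))
    (hm : ∀ Δ : Set (ℕ → X), MeasurableSet Δ → Measurable[tailAlgebra X] fun ξ => κ ξ Δ) :
    Set.extremePoints ℝ≥0 (disintegratedSet κ) = Set.range (molMeasure κ) := by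
  ext ρ
  constructor
  · intro h
    obtain ⟨hprob, -, hd⟩ := h.1
    have htriv := isTailTrivial_of_mem_extremePoints hRegular h
    have hae := hd.ae_eq hp (fun _ => hprob) hm (fun _ _ => measurable_const)
      htriv.isDisintegratedBy_const
    obtain ⟨ξ, hξ, hreg⟩ := (hae.and (hd.ae_mem_regularSet hp hm)).exists
    exact ⟨toMolecule κ ⟨ξ, hreg⟩, hξ⟩
  · rintro ⟨ν, rfl⟩
    obtain ⟨⟨ξ, hξ⟩, rfl⟩ := surjective_toMolecule ν
    rw [molMeasure_toMolecule]
    refine ⟨⟨hp ξ, hRegular _ (hp ξ), hξ.1⟩, ?_⟩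
    rintro ρ₁ ⟨h₁, -, hd₁⟩ ρ₂ - ⟨a, b, ha, -, -, hab⟩
    -- A component of positive weight is dominated by `κ ξ`, so `κ` is `ρ₁`-almost surely `κ ξ`, and
    -- `ρ₁`, the average of `κ` over itself, equals `κ ξ`.
    have hac : ρ₁ ≪ κ ξ := by
      intro s hs
      rw [← hab, Measure.add_apply, Measure.smul_apply, ENNReal.smul_def, smul_eq_mul,
        add_eq_zero, mul_eq_zero] at hs
      exact hs.1.resolve_left (by simpa using ha.ne')
    have hae := hac.ae_le (ae_eq_of_molecule_apply hp hm hξ.2)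
    ext Δ hΔ
    have h1 := hd₁ Δ Set.univ hΔ MeasurableSet.univ
    rw [setLIntegral_univ, Set.univ_inter] at h1
    rw [← h1, lintegral_congr_ae (g := fun _ => κ ξ Δ)]
    · simp
    · filter_upwards [hae] with η hη
      simp only [hη]

end Molecules

end Histories

/-! ### The corollary -/

theorem corollary1p7
    {H : Type*} [NormedAddCommGroup H] [InnerProductSpace ℂ H] [CompleteSpace H]
    [TopologicalSpace.SeparableSpace H]
    {X : Type*} [Fintype X] [TopologicalSpace X] [DiscreteTopology X]
    [MeasurableSpace X] [DiscreteMeasurableSpace X]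
    (S : QuantumSystem H X) (hdec : S.IdealDecoherence) (habel : S.AsymptoticAbelianness)
    (ω : (H →L[ℂ] H) → ℂ) (hω : IsNormalState S.vN ω) :
    (∃! μ : Measure (ℕ → X), S.IsHistoryMeasure ω μ) ∧
    ∀ μ : Measure (ℕ → X), S.IsHistoryMeasure ω μ →
      (∃ κ : (ℕ → X) → Measure (ℕ → X), IsErgodicDisintegration μ κ) ∧
      ∀ κ : (ℕ → X) → Measure (ℕ → X), IsErgodicDisintegration μ κ →
        -- `𝓚` is convex, and its extreme points are exactly the measures `μ(· | ν)`
        Convex ℝ≥0 (disintegratedSet κ) ∧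
        Set.extremePoints ℝ≥0 (disintegratedSet κ) = Set.range (molMeasure κ) ∧
        -- every element of `𝓚` is carried by the union of the molecules that make up `Ξ^∞`,
        -- and `𝓚` can be described by disintegration over `Ξ^∞`
        MeasurableSet (regularSet κ) ∧
        (∀ ρ ∈ disintegratedSet κ, ρ (regularSet κ) = 1) ∧
        (∀ ρ : Measure (ℕ → X), ρ ∈ disintegratedSet κ ↔
          IsProbabilityMeasure ρ ∧ ρ.Regular ∧ IsMolDisintegrated ρ κ) ∧
        -- Choquet-type decomposition of the elements of `𝓚`, in particular of `μ_ω`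
        μ ∈ disintegratedSet κ ∧
        (∀ Δ : Set (ℕ → X), MeasurableSet Δ → Measurable fun ν => molMeasure κ ν Δ) ∧
        ∀ ρ ∈ disintegratedSet κ, ∃ P : Measure (MoleculeSpace κ),
          IsProbabilityMeasure P ∧ IsImage ρ κ P ∧ IsMixture ρ κ P ∧
          ∀ Q : Measure (MoleculeSpace κ), IsProbabilityMeasure Q → IsMixture ρ κ Q → Q = P := by
  refine ⟨S.existsUnique_isHistoryMeasure hdec hω, fun μ hμ => ?_⟩
  have hμp := hμ.isProbabilityMeasure
  refine ⟨exists_isErgodicDisintegration μ, fun κ hκ => ?_⟩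
  have hp := hκ.isProbabilityMeasure
  have hm := hκ.measurable
  have hreg := measurableSet_regularSet hp hm
  -- The space of histories is compact and metrizable, so every Borel probability measure on it is
  -- Radon.
  have hRegular : ∀ ρ : Measure (ℕ → X), IsProbabilityMeasure ρ → ρ.Regular :=
    fun ρ _ => inferInstance
  refine ⟨convex_disintegratedSet hRegular, extremePoints_disintegratedSet hRegular hp hm,
    tailAlgebra_le _ hreg, ?_, fun ρ => ?_, ⟨hμp, hRegular μ hμp, hκ.isDisintegratedBy⟩,
    fun Δ hΔ => measurable_molMeasure_apply hreg hm hΔ, ?_⟩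
  · rintro ρ ⟨hρ, -, hd⟩
    exact (mem_ae_iff_prob_eq_one (tailAlgebra_le _ hreg)).1 (hd.ae_mem_regularSet hp hm)
  · exact ⟨fun ⟨h1, h2, h3⟩ => ⟨h1, h2, h3.isMolDisintegrated hp hm⟩,
      fun ⟨h1, h2, h3⟩ => ⟨h1, h2, h3.isDisintegratedBy hp hm⟩⟩
  · rintro ρ ⟨hρ, -, hd⟩
    obtain ⟨P, hP, hPi⟩ := hd.exists_isImage hp hm
    refine ⟨P, hP, hPi, fun Δ hΔ => ?_, fun Q _ hQ => (hQ.isImage hp hm hreg).eq hPi⟩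
    rw [← setLIntegral_univ, hd.setLIntegral_molMeasure hm hreg hPi hΔ MeasurableSet.univ,
      preimageMol_univ, Set.inter_comm,
      measure_inter_conull (t := regularSet κ) (mem_ae_iff.1 (hd.ae_mem_regularSet hp hm))]
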